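/- **Theorem (Identification of limits).** Let $s\in(0,1)$, $m\ge 2$, $T>0$, $Q_T=\mathbb R\times(0,T)$, $\overline{Q_T}=\mathbb R\times[0,T]$, and let $v_0:\mathbb R\to\mathbb R$ be nondecreasing with $|v_0|\le M$. Let $(-\Delta)^s\phi(x)=c_{1,s}\,\mathrm{P.V.}\!\int (\phi(x)-\phi(x+y))|y|^{-1-2s}\,dy$ with $c_{1,s}=\frac{2^{2s}\Gamma((1+2s)/2)}{\sqrt\pi\,|\Gamma(-s)|}$. *Scheme.* For $h>0$ let $\omega_k=\omega_k(h)$, $k\in\mathbb Z$, satisfy $\omega_k=\omega_{-k}\ge0$, and put $(-\Delta)^s_h\phi(x)=\sum_{k\ne0}(\phi(x)-\phi(x+kh))\,\omega_k$; let $D_h\phi(x)=\frac{\phi(x+h)-\phi(x)}h$ if $(-\Delta)^s_h\phi(x)\le0$, $D_h\phi(x)=\frac{\phi(x)-\phi(x-h)}h$ otherwise, and $L_h[\phi]=-|D_h\phi|^{m-1}(-\Delta)_h^s\phi$. Assume * (consistency) for every bounded $\phi\in C^2(\mathbb R)$, $(-\Delta)^s_h\phi\to(-\Delta)^s\phi$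 locally uniformly as $h\to0^+$; * (weights) for some $C_s>0$ and all sufficiently small $h>0$: $\sum_{k\neq0}\omega_k\le C_sh^{-2s}$, $\sum_{|kh|>1}\omega_k\le C_s$, and $\sum_{0<|kh|\le1}|kh|\,\omega_k\le C_s\,g_s(h)$, where $g_s(h)=h^{1-2s}$ if $s>\frac12$, $g_s(h)=|\log h|$ if $s=\frac12$, $g_s(h)=1$ if $s<\frac12$. For each $h>0$ let $\tau=\tau(h)=T/J(h)$ with $J(h)$ a positive integer, and assume that one of the following CFL conditions holds for all sufficiently small $h>0$: * (CFL1) $C_s\,m\,(2M)^{m-1}\,\tau\le h^{2s+m-1}$; * (CFL2) $v_0$ is Lipschitz with constant $L$, and $C_s\,m\,L^{m-2}\max\{L,2M\}\,\tau\le h^{\max\{2s,1\}}f_s(h)$, where $f_s=1$ if $s\ne\frac12$ and $f_s(h)=1/|\log h|$ if $s=\frac12$. Let $V_h:\overline{Q_T}\to\mathbb R$ be the extended scheme solution: $V_h(x,t)=v_0(x)$ for $t\in[0,\tau)$, and $V_h(x,t+\tau)=V_h(x,t)+\tau L_h[V_h(\cdot,t)](x)$ for $x\in\mathbb R$, $t\in[0,T-\tau]$.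 Define the half-relaxed limits on $\overline{Q_T}$ $$\overline v(x,t)=\limsup_{(y,r,h)\to(x,t,0^+)}V_h(y,r),\qquad \underline v(x,t)=\liminf_{(y,r,h)\to(x,t,0^+)}V_h(y,r),\qquad (y,r)\in\overline{Q_T}.$$ Then $\overline v$ is a viscosity subsolution and $\underline v$ is a viscosity supersolution of $$\partial_tv+|\partial_xv|^{m-1}(-\Delta)^sv=0\ \text{ in }Q_T,\qquad v(\cdot,0)=v_0 .$$ Here a viscosity subsolution (resp. supersolution) is a bounded upper (resp. lower) semicontinuous $v:\overline{Q_T}\to\mathbb R$ such that, with $E[\phi]=\phi_t+|\phi_x|^{m-1}(-\Delta)^s\phi$: 1. for every bounded $\phi\in C^2(Q_T)$ and every global maximum (resp. minimum) point $(x_0,t_0)$ of $v-\phi$ in $Q_T$, $E[\phi](x_0,t_0)\le0$ (resp. $\ge0$); 2. for every bounded $\phi\in C^2(\overline{Q_T})$ and every global maximum (resp. minimum) point over $\overline{Q_T}$ of $v-\phi$ of the form $(x_0,0)$, $\min\{v(x_0,0)-(v_0)^*(x_0),\,E[\phi](x_0,0)\}\le0$ (resp. $\max\{v(x_0,0)-(v_0)_*(x_0),\,E[\phi](x_0,0)\}\ge0$),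 where $(v_0)^*$ and $(v_0)_*$ are the upper and lower semicontinuous envelopes of $v_0$, and $\phi_t(x_0,0)$ is the one-sided derivative. -/

import Mathlib

open Set Filter Topology

noncomputable section

/-- The fractional Laplacian `(-Δ)^s` in one space dimension, as the principal value integral
`c_{1,s} P.V. ∫ (φ(x) - φ(x+y)) |y|^{-(1+2s)} dy`. -/
def fracLap (s : ℝ) (φ : ℝ → ℝ) (x : ℝ) : ℝ :=
  (2 ^ (2 * s) * Real.Gamma ((1 + 2 * s) / 2) / (Real.sqrt Real.pi * |Real.Gamma (-s)|)) *
    limUnder (𝓝[>] (0 : ℝ)) fun ε : ℝ =>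
      ∫ y in {y : ℝ | ε < |y|}, (φ x - φ (x + y)) / |y| ^ (1 + 2 * s)

/-- The open space-time cylinder `Q_T = ℝ × (0,T)`. -/
def openCyl (T : ℝ) : Set (ℝ × ℝ) := univ ×ˢ Ioo 0 T

/-- The closed space-time cylinder `ℝ × [0,T]`. -/
def closedCyl (T : ℝ) : Set (ℝ × ℝ) := univ ×ˢ Icc 0 T

/-- Upper semicontinuous envelope (the limsup includes the point itself). -/
def upperEnv (f : ℝ → ℝ) (x : ℝ) : ℝ := limsup f (𝓝 x)

/-- Lower semicontinuous envelope. -/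
def lowerEnv (f : ℝ → ℝ) (x : ℝ) : ℝ := liminf f (𝓝 x)

/-- `φ_t + |φ_x|^{m-1} (-Δ)^s φ` at `(x,t)`. The time derivative is taken within `[0,T]`: it is
the usual one for `0 < t < T` and the one-sided one at `t = 0`. -/
def eqnOp (s m T : ℝ) (φ : ℝ × ℝ → ℝ) (x t : ℝ) : ℝ :=
  derivWithin (fun r => φ (x, r)) (Icc 0 T) t +
    |deriv (fun y => φ (y, t)) x| ^ (m - 1) * fracLap s (fun y => φ (y, t)) x

/-- `φ ∈ C² ∩ C_b (Q)`. -/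
def IsTestFun (Q : Set (ℝ × ℝ)) (φ : ℝ × ℝ → ℝ) : Prop :=
  ContDiffOn ℝ 2 φ Q ∧ ∃ B : ℝ, ∀ p ∈ Q, |φ p| ≤ B

/-- `v` is a (bounded, upper semicontinuous) viscosity subsolution of
`v_t + |v_x|^{m-1} (-Δ)^s v = 0` in `ℝ × (0,T)`, `v(·,0) = v₀`, on `ℝ × [0,T]`. -/
structure IsViscSubsol (s m T : ℝ) (v₀ : ℝ → ℝ) (v : ℝ × ℝ → ℝ) : Prop where
  bounded : ∃ B : ℝ, ∀ p ∈ closedCyl T, |v p| ≤ B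
  usc : UpperSemicontinuousOn v (closedCyl T)
  interior : ∀ φ : ℝ × ℝ → ℝ, IsTestFun (openCyl T) φ →
    ∀ x₀ t₀ : ℝ, (x₀, t₀) ∈ openCyl T → IsMaxOn (fun p => v p - φ p) (openCyl T) (x₀, t₀) →
      eqnOp s m T φ x₀ t₀ ≤ 0
  initial : ∀ φ : ℝ × ℝ → ℝ, IsTestFun (closedCyl T) φ →
    ∀ x₀ : ℝ, IsMaxOn (fun p => v p - φ p) (closedCyl T) (x₀, 0) →
      min (v (x₀, 0) - upperEnv v₀ x₀) (eqnOp s m T φ x₀ 0) ≤ 0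

/-- `v` is a (bounded, lower semicontinuous) viscosity supersolution of the same problem. -/
structure IsViscSupersol (s m T : ℝ) (v₀ : ℝ → ℝ) (v : ℝ × ℝ → ℝ) : Prop where
  bounded : ∃ B : ℝ, ∀ p ∈ closedCyl T, |v p| ≤ B
  lsc : LowerSemicontinuousOn v (closedCyl T)
  interior : ∀ φ : ℝ × ℝ → ℝ, IsTestFun (openCyl T) φ →
    ∀ x₀ t₀ : ℝ, (x₀, t₀) ∈ openCyl T → IsMinOn (fun p => v p - φ p) (openCyl T) (x₀, t₀) →
      0 ≤ eqnOp s m T φ x₀ t₀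
  initial : ∀ φ : ℝ × ℝ → ℝ, IsTestFun (closedCyl T) φ →
    ∀ x₀ : ℝ, IsMinOn (fun p => v p - φ p) (closedCyl T) (x₀, 0) →
      0 ≤ max (v (x₀, 0) - lowerEnv v₀ x₀) (eqnOp s m T φ x₀ 0)

/-- The discrete fractional Laplacian `∑_{k ≠ 0} (φ(x) - φ(x + k h)) ω_k`, where `w k = ω_k` are
the weights belonging to the grid size `h`. -/
def discFracLap (h : ℝ) (w : ℤ → ℝ) (φ : ℝ → ℝ) (x : ℝ) : ℝ :=
  ∑' k : {k : ℤ // k ≠ 0}, (φ x - φ (x + (k : ℤ) * h)) * w k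

/-- The upwind finite difference. -/
def upwindDiff (h : ℝ) (w : ℤ → ℝ) (φ : ℝ → ℝ) (x : ℝ) : ℝ :=
  open scoped Classical in
  if discFracLap h w φ x ≤ 0 then (φ (x + h) - φ x) / h else (φ x - φ (x - h)) / h

/-- The discrete quasilinear operator `L_h[φ] = -|D_h φ|^{m-1} (-Δ)_h^s φ`. -/
def discOp (m h : ℝ) (w : ℤ → ℝ) (φ : ℝ → ℝ) (x : ℝ) : ℝ :=
  -(|upwindDiff h w φ x| ^ (m - 1) * discFracLap h w φ x)

/-- The explicit Euler iterates, at every point of the line: `V⁰ = v₀`,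
`V^{j+1} = V^j + τ L_h[V^j]`. -/
def schemeIter (m h τ : ℝ) (w : ℤ → ℝ) (v₀ : ℝ → ℝ) : ℕ → ℝ → ℝ
  | 0 => v₀
  | j + 1 => fun x =>
      schemeIter m h τ w v₀ j x + τ * discOp m h w (schemeIter m h τ w v₀ j) x

/-- The extended scheme solution `V_h(x,t)`: it equals `V^j(x)` for `t ∈ [jτ, (j+1)τ)`. -/
def extScheme (m h τ : ℝ) (w : ℤ → ℝ) (v₀ : ℝ → ℝ) (p : ℝ × ℝ) : ℝ :=
  schemeIter m h τ w v₀ ⌊p.2 / τ⌋₊ p.1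

theorem extScheme_initial (m h τ : ℝ) (w : ℤ → ℝ) (v₀ : ℝ → ℝ) (x t : ℝ)
    (ht : t ∈ Ico 0 τ) : extScheme m h τ w v₀ (x, t) = v₀ x := by
  have hτ : 0 < τ := lt_of_le_of_lt ht.1 ht.2
  have h0 : ⌊t / τ⌋₊ = 0 := Nat.floor_eq_zero.2 ((div_lt_one hτ).2 ht.2)
  simp [extScheme, h0, schemeIter]

theorem extScheme_step (m h τ : ℝ) (w : ℤ → ℝ) (v₀ : ℝ → ℝ) (x t : ℝ)
    (hτ : 0 < τ) (ht : 0 ≤ t) :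
    (extScheme m h τ w v₀ (x, t + τ) - extScheme m h τ w v₀ (x, t)) / τ =
      discOp m h w (fun y => extScheme m h τ w v₀ (y, t)) x := by
  have h1 : ⌊(t + τ) / τ⌋₊ = ⌊t / τ⌋₊ + 1 := by
    rw [add_div, div_self hτ.ne', Nat.floor_add_one (div_nonneg ht hτ.le)]
  simp only [extScheme, h1, schemeIter]
  field_simp
  ring

/-- Upper half-relaxed limit on `ℝ × [0,T]` of a family `V_h` as `h → 0⁺`:
the limsup of `V_h(y,r)` as `(y,r,h) → (x,t,0⁺)` with `(y,r) ∈ ℝ × [0,T]`. -/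
def upperRelaxedLimit (T : ℝ) (V : ℝ → ℝ × ℝ → ℝ) (p : ℝ × ℝ) : ℝ :=
  limsup (fun q : ℝ × (ℝ × ℝ) => V q.1 q.2) (𝓝[>] (0 : ℝ) ×ˢ 𝓝[closedCyl T] p)

/-- Lower half-relaxed limit. -/
def lowerRelaxedLimit (T : ℝ) (V : ℝ → ℝ × ℝ → ℝ) (p : ℝ × ℝ) : ℝ :=
  liminf (fun q : ℝ × (ℝ × ℝ) => V q.1 q.2) (𝓝[>] (0 : ℝ) ×ˢ 𝓝[closedCyl T] p)

/-- Consistency of the discretization with weights `ω h k`: `(-Δ)_h^s φ → (-Δ)^s φ` locally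
uniformly as `h → 0⁺`, for all bounded `φ ∈ C²(ℝ)`. -/
def ConsistentWeights (s : ℝ) (ω : ℝ → ℤ → ℝ) : Prop :=
  ∀ φ : ℝ → ℝ, ContDiff ℝ 2 φ → (∃ B : ℝ, ∀ x, |φ x| ≤ B) →
    TendstoLocallyUniformly (fun h => discFracLap h (ω h) φ) (fracLap s φ) (𝓝[>] (0 : ℝ))

/-- The bounds on the weights `w` belonging to the grid size `h`, with constant `Cs`. -/
structure WeightBounds (s Cs h : ℝ) (w : ℤ → ℝ) : Prop where
  summable : Summable fun k : {k : ℤ // k ≠ 0} => w k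
  total : ∑' k : {k : ℤ // k ≠ 0}, w k ≤ Cs * h ^ (-(2 * s))
  far : ∑' k : {k : ℤ // 1 < |(k : ℝ) * h|}, w k ≤ Cs
  near : ∑' k : {k : ℤ // 0 < |(k : ℝ) * h| ∧ |(k : ℝ) * h| ≤ 1}, |h * ((k : ℤ) : ℝ)| * w k ≤
    open scoped Classical in
    Cs * (if 1 / 2 < s then h ^ (1 - 2 * s) else if s = 1 / 2 then |Real.log h| else 1)

/-- First CFL condition `τ ≤ C₁ h^{2s+m-1}`, `C₁⁻¹ = C_s m (2M)^{m-1}`, with the constant moved to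
the left (no restriction if `M = 0`). -/
def CFL1 (s m Cs M h τ : ℝ) : Prop :=
  Cs * m * (2 * M) ^ (m - 1) * τ ≤ h ^ (2 * s + m - 1)

/-- Second CFL condition `τ ≤ C₂ h^{max(2s,1)} f_s(h)`, `C₂⁻¹ = C_s m L^{m-2} max(L, 2M)`, with
`f_s(h) = 1` for `s ≠ 1/2` and `f_s(h) = 1/|log h|` for `s = 1/2`. -/
def CFL2 (s m Cs M L h τ : ℝ) : Prop :=
  open scoped Classical in
  Cs * m * L ^ (m - 2) * max L (2 * M) * τ ≤
    h ^ (max (2 * s) 1) * (if s = 1 / 2 then 1 / |Real.log h| else 1)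

end

/-!
The argument is the Barles–Souganidis scheme: monotonicity, stability and consistency give that
half-relaxed limits are viscosity semi-solutions. Three points are special to this equation.

*Monotonicity.* The scheme is monotone only on nondecreasing functions of controlled slope, whereas
a test function need be neither. `scheme_comparison` therefore compares a step from a nondecreasing
`V` with a step from an arbitrary `W ≥ V` in which the slope of `W` is cut off to `[0, P]`, where
`P` bounds the slopes of `V`. Among nondecreasing functions this is ordinary comparison, and
comparing an iterate with its translates and with constants shows that monotonicity in `x`, the
bound `M` and the Lipschitz constant of the datum persist (`SlopeBounds.step_mono`,
`SlopeBounds.step_bounded`, `SlopeBounds.step_lipschitz`). This needs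
`τ ((m - 1) P ^ (m - 2) A / h + P ^ (m - 1) ∑ ω) ≤ 1` with `A` a bound on the discrete fractional
Laplacian. Under the first CFL condition one takes `P = 2 M / h`; under the second, `P = L`
(`stableScheme_of_CFL1`, `stableScheme_of_CFL2`).

*Consistency in time.* Consistency is assumed for a fixed function of `x` only. For the slices of a
test function `φ(x, t)` one bounds second differences of `φ(·, t) - φ(·, t₀)` near the point, and
uses that the weights have uniformly small tails far from it. The latter follows by testing
consistency with `y² / (R² + y²)`, whose fractional Laplacian at the origin tends to `0` as
`R → ∞` (`fracLap_bump_tendsto`, `ConsistentWeights.tendsto_slice`). All linearity and symmetry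
properties of the principal value operator that are used come from those of its discretization.

*Passage to the limit.* The same bump, with a large factor, confines the approximate maximum points
of `V_h - φ` to a compact set (`frequently_approx_max`). There the slope cut-off is harmless: at such
points the difference quotients of `φ` are asymptotically between `0` and `P`, because those of `V_h`
are (`eqn_le_zero_of_frequently_approx_max`). At the initial time, if the relaxed limit exceeds the
upper envelope of the datum, these points lie beyond the first time step.

The supersolution property follows from the subsolution property through `v ↦ -v(-x, t)`, which
preserves the scheme and the class of data.
-/

noncomputable section

/-! ### Algebra of the discrete operator -/

/-- The weights with the one at the origin replaced by `0`. -/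
def puncture (w : ℤ → ℝ) (k : ℤ) : ℝ := if k = 0 then 0 else w k

/-- Symmetric nonnegative weights which are summable off the origin. -/
structure AdmissibleWeights (w : ℤ → ℝ) : Prop where
  symm : ∀ k, w (-k) = w k
  nonneg : ∀ k, 0 ≤ w k
  summable : Summable fun k : {k : ℤ // k ≠ 0} => w k

theorem puncture_eq_indicator (w : ℤ → ℝ) : puncture w = {k : ℤ | k ≠ 0}.indicator w := by
  funext k
  by_cases hk : k = 0 <;> simp [puncture, hk]

theorem tsum_puncture (w : ℤ → ℝ) :
    ∑' k : {k : ℤ // k ≠ 0}, w k = ∑' k, puncture w k := by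
  rw [puncture_eq_indicator]
  exact tsum_subtype {k : ℤ | k ≠ 0} w

theorem discFracLap_eq (h : ℝ) (w : ℤ → ℝ) (φ : ℝ → ℝ) (x : ℝ) :
    discFracLap h w φ x = ∑' k : ℤ, (φ x - φ (x + k * h)) * puncture w k := by
  have := tsum_subtype {k : ℤ | k ≠ 0} fun k : ℤ => (φ x - φ (x + k * h)) * w k
  refine Eq.trans this (tsum_congr fun k => ?_)
  by_cases hk : k = 0 <;> simp [puncture, hk]

namespace AdmissibleWeights

variable {w : ℤ → ℝ}

theorem puncture_summable (hw : AdmissibleWeights w) : Summable (puncture w) := by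
  rw [puncture_eq_indicator]
  exact summable_subtype_iff_indicator.1 hw.summable

theorem puncture_nonneg (hw : AdmissibleWeights w) (k : ℤ) : 0 ≤ puncture w k := by
  unfold puncture
  split_ifs
  · exact le_rfl
  · exact hw.nonneg k

theorem puncture_neg (hw : AdmissibleWeights w) (k : ℤ) : puncture w (-k) = puncture w k := by
  simp [puncture, hw.symm]

theorem summable_mul (hw : AdmissibleWeights w) {u : ℤ → ℝ} {B : ℝ} (hu : ∀ k, |u k| ≤ B) :
    Summable fun k => u k * puncture w k := by
  refine Summable.of_norm_bounded (hw.puncture_summable.mul_left B) fun k => ?_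
  rw [Real.norm_eq_abs, abs_mul, abs_of_nonneg (hw.puncture_nonneg k)]
  exact mul_le_mul_of_nonneg_right (hu k) (hw.puncture_nonneg k)

theorem summable_sub (hw : AdmissibleWeights w) (h : ℝ) {φ : ℝ → ℝ} {B : ℝ}
    (hφ : ∀ x, |φ x| ≤ B) (x : ℝ) :
    Summable fun k : ℤ => (φ x - φ (x + k * h)) * puncture w k :=
  hw.summable_mul (B := B + B) fun _ =>
    (abs_sub _ _).trans (add_le_add (hφ _) (hφ _))

theorem total_nonneg (hw : AdmissibleWeights w) : 0 ≤ ∑' k, puncture w k :=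
  tsum_nonneg hw.puncture_nonneg

theorem discFracLap_add (hw : AdmissibleWeights w) (h : ℝ) {φ ψ : ℝ → ℝ} {B B' : ℝ}
    (hφ : ∀ x, |φ x| ≤ B) (hψ : ∀ x, |ψ x| ≤ B') (x : ℝ) :
    discFracLap h w (fun y => φ y + ψ y) x = discFracLap h w φ x + discFracLap h w ψ x := by
  simp only [discFracLap_eq]
  rw [← (hw.summable_sub h hφ x).tsum_add (hw.summable_sub h hψ x)]
  exact tsum_congr fun k => by ring

/-- Pairing `k` with `-k` turns first differences into second differences. -/
theorem discFracLap_eq_half (hw : AdmissibleWeights w) (h : ℝ) {φ : ℝ → ℝ} {B : ℝ}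
    (hφ : ∀ x, |φ x| ≤ B) (x : ℝ) :
    discFracLap h w φ x =
      ∑' k : ℤ, (2 * φ x - φ (x + k * h) - φ (x - k * h)) / 2 * puncture w k := by
  have h1 := hw.summable_sub h hφ x
  have h2 : Summable fun k : ℤ => (φ x - φ (x - k * h)) * puncture w k :=
    hw.summable_mul (B := B + B) fun _ =>
      (abs_sub _ _).trans (add_le_add (hφ _) (hφ _))
  have h3 : ∑' k : ℤ, (φ x - φ (x + k * h)) * puncture w k
      = ∑' k : ℤ, (φ x - φ (x - k * h)) * puncture w k := by
    rw [← (Equiv.neg ℤ).tsum_eq]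
    refine tsum_congr fun k => ?_
    simp only [Equiv.neg_apply, hw.puncture_neg]
    push_cast
    ring_nf
  have h4 := (h1.tsum_add h2)
  rw [← h3] at h4
  have h5 : ∑' k : ℤ, (2 * φ x - φ (x + k * h) - φ (x - k * h)) / 2 * puncture w k
      = (1 / 2) * ∑' k : ℤ, ((φ x - φ (x + k * h)) * puncture w k +
          (φ x - φ (x - k * h)) * puncture w k) := by
    rw [← tsum_mul_left]
    exact tsum_congr fun k => by ring
  rw [h5, h4, discFracLap_eq]
  ring

theorem abs_discFracLap_le (hw : AdmissibleWeights w) (h : ℝ) {φ : ℝ → ℝ} {B : ℝ}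
    (hφ : ∀ x, |φ x| ≤ B) (x : ℝ) {b : ℤ → ℝ}
    (hb : ∀ k : ℤ, |2 * φ x - φ (x + k * h) - φ (x - k * h)| ≤ b k)
    (hs : Summable fun k => b k * puncture w k) :
    |discFracLap h w φ x| ≤ (1 / 2) * ∑' k, b k * puncture w k := by
  rw [hw.discFracLap_eq_half h hφ, ← tsum_mul_left, ← Real.norm_eq_abs]
  refine tsum_of_norm_bounded (hs.mul_left (1 / 2)).hasSum fun k => ?_
  rw [Real.norm_eq_abs, abs_mul, abs_of_nonneg (hw.puncture_nonneg k), abs_div,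
    abs_of_pos (two_pos : (0 : ℝ) < 2)]
  have := mul_le_mul_of_nonneg_right (hb k) (hw.puncture_nonneg k)
  linarith

/-- Raising a function by `d ≥ 0`, with the value at `x` raised by `d x`, raises the discrete
fractional Laplacian at `x` by at most `d x` times the total weight. -/
theorem discFracLap_le_add (hw : AdmissibleWeights w) (h : ℝ) {V W : ℝ → ℝ} {B B' : ℝ}
    (hV : ∀ x, |V x| ≤ B) (hW : ∀ x, |W x| ≤ B') (hVW : ∀ x, V x ≤ W x) (x : ℝ) :
    discFracLap h w W x ≤ discFracLap h w V x + (W x - V x) * ∑' k, puncture w k := by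
  rw [discFracLap_eq, discFracLap_eq, ← tsum_mul_left,
    ← (hw.summable_sub h hV x).tsum_add (hw.puncture_summable.mul_left _)]
  refine (hw.summable_sub h hW x).tsum_le_tsum (fun k => ?_)
    ((hw.summable_sub h hV x).add (hw.puncture_summable.mul_left _))
  have := mul_le_mul_of_nonneg_right (hVW (x + k * h)) (hw.puncture_nonneg k)
  nlinarith

end AdmissibleWeights

theorem discFracLap_add_const (h : ℝ) (w : ℤ → ℝ) (φ : ℝ → ℝ) (c x : ℝ) :
    discFracLap h w (fun y => φ y + c) x = discFracLap h w φ x := by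
  simp [discFracLap]

theorem upwindDiff_add_const (h : ℝ) (w : ℤ → ℝ) (φ : ℝ → ℝ) (c x : ℝ) :
    upwindDiff h w (fun y => φ y + c) x = upwindDiff h w φ x := by
  simp [upwindDiff, discFracLap_add_const]

theorem discOp_add_const (m h : ℝ) (w : ℤ → ℝ) (φ : ℝ → ℝ) (c x : ℝ) :
    discOp m h w (fun y => φ y + c) x = discOp m h w φ x := by
  simp [discOp, discFracLap_add_const, upwindDiff_add_const]

theorem discFracLap_translate (h : ℝ) (w : ℤ → ℝ) (φ : ℝ → ℝ) (z x : ℝ) :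
    discFracLap h w (fun y => φ (y + z)) x = discFracLap h w φ (x + z) := by
  simp only [discFracLap]
  exact tsum_congr fun k => by rw [add_right_comm]

theorem discOp_translate (m h : ℝ) (w : ℤ → ℝ) (φ : ℝ → ℝ) (z x : ℝ) :
    discOp m h w (fun y => φ (y + z)) x = discOp m h w φ (x + z) := by
  simp only [discOp, upwindDiff, discFracLap_translate]
  rw [add_right_comm, show x - h + z = x + z - h by ring]

theorem discFracLap_const (h : ℝ) (w : ℤ → ℝ) (c x : ℝ) :
    discFracLap h w (fun _ => c) x = 0 := by
  simp [discFracLap]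

theorem discOp_const (m h : ℝ) (w : ℤ → ℝ) (c x : ℝ) : discOp m h w (fun _ => c) x = 0 := by
  simp [discOp, discFracLap_const]

theorem discFracLap_const_mul (h : ℝ) (w : ℤ → ℝ) (φ : ℝ → ℝ) (c x : ℝ) :
    discFracLap h w (fun y => c * φ y) x = c * discFracLap h w φ x := by
  simp only [discFracLap, ← tsum_mul_left]
  exact tsum_congr fun k => by ring

theorem discFracLap_reflect {w : ℤ → ℝ} (hsymm : ∀ k, w (-k) = w k) (h : ℝ) (φ : ℝ → ℝ) (x : ℝ) :
    discFracLap h w (fun y => -φ (-y)) x = -discFracLap h w φ (-x) := by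
  have hp : ∀ k, puncture w (-k) = puncture w k := fun k => by simp [puncture, hsymm]
  rw [discFracLap_eq, discFracLap_eq, ← tsum_neg, ← (Equiv.neg ℤ).tsum_eq]
  refine tsum_congr fun k => ?_
  simp only [Equiv.neg_apply, hp]
  push_cast
  rw [show -(x + -(k : ℝ) * h) = -x + k * h by ring]
  ring

/-- The upwind choice is compatible with the reflection `φ ↦ -φ(-·)`, which exchanges the forward
and the backward difference and the sign of the discrete fractional Laplacian. -/
theorem discOp_reflect {m : ℝ} {w : ℤ → ℝ} (hsymm : ∀ k, w (-k) = w k) (h : ℝ)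
    (φ : ℝ → ℝ) (x : ℝ) :
    discOp m h w (fun y => -φ (-y)) x = -discOp m h w φ (-x) := by
  have e1 : -(x + h) = -x - h := by ring
  have e2 : -(x - h) = -x + h := by ring
  rcases lt_trichotomy (discFracLap h w φ (-x)) 0 with ha | ha | ha
  · simp only [discOp, upwindDiff, discFracLap_reflect hsymm, e2]
    rw [if_neg (by linarith), if_pos ha.le]
    ring_nf
  · simp [discOp, discFracLap_reflect hsymm, ha]
  · simp only [discOp, upwindDiff, discFracLap_reflect hsymm, e1]
    rw [if_pos (by linarith), if_neg (by linarith)]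
    ring_nf

theorem rpow_sub_rpow_le {p a b P : ℝ} (hp : 1 ≤ p) (ha : 0 ≤ a) (hab : a ≤ b) (hb : b ≤ P) :
    b ^ p - a ^ p ≤ p * P ^ (p - 1) * (b - a) := by
  rcases (ha.trans hab).eq_or_lt with h0 | h0
  · have : a = 0 := le_antisymm (hab.trans h0.symm.le) ha
    subst this
    simp [← h0]
  have h1 := one_add_mul_self_le_rpow_one_add (s := a / b - 1)
    (by have := div_nonneg ha h0.le; linarith) hp
  rw [add_sub_cancel, Real.div_rpow ha h0.le] at h1
  have h2 : 0 < b ^ p := Real.rpow_pos_of_pos h0 p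
  rw [le_div_iff₀ h2] at h1
  have h3 : b ^ p = b ^ (p - 1) * b := by
    rw [← Real.rpow_add_one h0.ne', sub_add_cancel]
  have h4 : (1 + p * (a / b - 1)) * b ^ p = b ^ p - p * b ^ (p - 1) * (b - a) := by
    rw [h3]
    field_simp
    ring
  have h5 : b ^ (p - 1) ≤ P ^ (p - 1) := Real.rpow_le_rpow h0.le hb (by linarith)
  have h6 : p * b ^ (p - 1) * (b - a) ≤ p * P ^ (p - 1) * (b - a) := by
    have : 0 ≤ b - a := by linarith
    gcongr
  linarith

/-! ### Comparison for one time step -/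

theorem rpow_sub_rpow_le_of_le_add {p a b P δ : ℝ} (hp : 1 ≤ p) (ha : 0 ≤ a) (hb : 0 ≤ b)
    (hbP : b ≤ P) (hδ : 0 ≤ δ) (hab : b ≤ a + δ) :
    b ^ p - a ^ p ≤ p * P ^ (p - 1) * δ := by
  have hP : 0 ≤ p * P ^ (p - 1) :=
    mul_nonneg (by linarith) (Real.rpow_nonneg (hb.trans hbP) _)
  rcases le_total a b with h | h
  · refine (rpow_sub_rpow_le hp ha h hbP).trans ?_
    exact mul_le_mul_of_nonneg_left (by linarith) hP
  · have := Real.rpow_le_rpow hb h (by linarith : (0 : ℝ) ≤ p)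
    have := mul_nonneg hP hδ
    linarith

/-- One time step of the scheme from `V` stays below one step of a modified scheme from any
`W ≥ V`, provided that the slopes of `V` at `x` lie in `[0, P]` and the time step is small. The
modification consists in cutting the slope of `W` off to `[0, P]`; it makes the lemma applicable
to functions `W` which are neither monotone nor of slope at most `P`, such as test functions. -/
theorem scheme_comparison {m h τ P A B B' : ℝ} {w : ℤ → ℝ} (hw : AdmissibleWeights w)
    (hm : 2 ≤ m) (hh : 0 < h) (hτ : 0 < τ) (hP : 0 ≤ P) {V W : ℝ → ℝ}
    (hV : ∀ x, |V x| ≤ B) (hW : ∀ x, |W x| ≤ B') (hVW : ∀ x, V x ≤ W x) (x : ℝ)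
    (hf0 : V x ≤ V (x + h)) (hf1 : V (x + h) - V x ≤ P * h)
    (hb0 : V (x - h) ≤ V x)
    (hA : |discFracLap h w V x| ≤ A)
    (hcfl : τ * ((m - 1) * P ^ (m - 2) * A / h + P ^ (m - 1) * ∑' k, puncture w k) ≤ 1) :
    V x + τ * discOp m h w V x ≤
      W x - τ * (max 0 (min (upwindDiff h w W x) P) ^ (m - 1) * discFracLap h w W x) := by
  have hΩ := hw.total_nonneg
  have hba := hw.discFracLap_le_add h hV hW hVW x
  set Ω := ∑' k, puncture w k
  set a := discFracLap h w V x with ha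
  set b := discFracLap h w W x with hb
  set c := W x - V x with hc
  have hc0 : 0 ≤ c := sub_nonneg.2 (hVW x)
  have hA0 : 0 ≤ A := (abs_nonneg _).trans hA
  obtain ⟨hA1, hA2⟩ := abs_le.1 hA
  set r := max 0 (min (upwindDiff h w W x) P) with hr
  have hr0 : 0 ≤ r := le_max_left _ _
  have hrP : r ≤ P := max_le hP (min_le_right _ _)
  have hn : (1 : ℝ) ≤ m - 1 := by linarith
  have hn0 : (0 : ℝ) ≤ m - 1 := by linarith
  have hch : 0 ≤ c / h := div_nonneg hc0 hh.le
  have hPm : 0 ≤ P ^ (m - 1) := Real.rpow_nonneg hP _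
  have hPm2 : 0 ≤ (m - 1) * P ^ (m - 2) := mul_nonneg hn0 (Real.rpow_nonneg hP _)
  have hrm0 : 0 ≤ r ^ (m - 1) := Real.rpow_nonneg hr0 _
  have hrm : r ^ (m - 1) ≤ P ^ (m - 1) := Real.rpow_le_rpow hr0 hrP hn0
  have hcΩ : 0 ≤ c * Ω := mul_nonneg hc0 hΩ
  have hS : 0 ≤ (m - 1) * P ^ (m - 2) * (c / h) * A := by positivity
  -- It suffices to bound the difference of the two fluxes by the left side of `hcfl`.
  suffices H : r ^ (m - 1) * b - |upwindDiff h w V x| ^ (m - 1) * a ≤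
      (m - 1) * P ^ (m - 2) * (c / h) * A + P ^ (m - 1) * (c * Ω) by
    have h1 := mul_le_mul_of_nonneg_left H hτ.le
    have h2 := mul_le_mul_of_nonneg_left hcfl hc0
    have h3 : τ * ((m - 1) * P ^ (m - 2) * (c / h) * A + P ^ (m - 1) * (c * Ω)) =
        c * (τ * ((m - 1) * P ^ (m - 2) * A / h + P ^ (m - 1) * Ω)) := by
      ring
    rw [h3] at h1
    simp only [discOp, ← ha]
    nlinarith
  have hlip : ∀ {y z : ℝ}, 0 ≤ y → 0 ≤ z → z ≤ P → z ≤ y + c / h →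
      z ^ (m - 1) - y ^ (m - 1) ≤ (m - 1) * P ^ (m - 2) * (c / h) := by
    intro y z hy hz hzP hzy
    have := rpow_sub_rpow_le_of_le_add hn hy hz hzP hch hzy
    rwa [show m - 1 - 1 = m - 2 by ring] at this
  have hf2 := hVW (x + h)
  have hb2 := hVW (x - h)
  rcases le_or_gt a 0 with ha0 | ha0
  · have hpe : upwindDiff h w V x = (V (x + h) - V x) / h := by
      unfold upwindDiff
      rw [if_pos ha0]
    rw [hpe]
    set p := (V (x + h) - V x) / h with hp
    have hp0 : 0 ≤ p := div_nonneg (by linarith) hh.le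
    have hpP : p ≤ P := (div_le_iff₀ hh).2 hf1
    rw [abs_of_nonneg hp0]
    have hpm0 : 0 ≤ p ^ (m - 1) := Real.rpow_nonneg hp0 _
    have hpm : p ^ (m - 1) ≤ P ^ (m - 1) := Real.rpow_le_rpow hp0 hpP hn0
    rcases le_or_gt b 0 with hb0' | hb0'
    · have hqe : upwindDiff h w W x = (W (x + h) - W x) / h := by
        unfold upwindDiff
        rw [if_pos hb0']
      have hq : p ≤ r + c / h := by
        have : p - c / h ≤ (W (x + h) - W x) / h := by
          rw [hp, ← sub_div]
          exact div_le_div_of_nonneg_right (by linarith) hh.le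
        have h4 : p - c / h ≤ min (upwindDiff h w W x) P := by
          rw [hqe]
          exact le_min this (by linarith)
        have := h4.trans (le_max_right 0 _)
        linarith
      have h1 := mul_le_mul_of_nonneg_right (hlip hr0 hp0 hpP hq) (neg_nonneg.2 ha0)
      have h2 := mul_le_mul_of_nonneg_left hba hrm0
      have h3 := mul_le_mul_of_nonneg_right hrm hcΩ
      have h4 : (m - 1) * P ^ (m - 2) * (c / h) * (-a) ≤ (m - 1) * P ^ (m - 2) * (c / h) * A :=
        mul_le_mul_of_nonneg_left (by linarith) (by positivity)
      linarith
    · have h1 := mul_le_mul_of_nonneg_right hrm hb0'.le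
      have h2 := mul_le_mul_of_nonneg_right hpm (neg_nonneg.2 ha0)
      have h3 : P ^ (m - 1) * (b - a) ≤ P ^ (m - 1) * (c * Ω) :=
        mul_le_mul_of_nonneg_left (by linarith) hPm
      linarith
  · have hpe : upwindDiff h w V x = (V x - V (x - h)) / h := by
      unfold upwindDiff
      rw [if_neg (not_le.2 ha0)]
    rw [hpe]
    set p := (V x - V (x - h)) / h with hp
    have hp0 : 0 ≤ p := div_nonneg (by linarith) hh.le
    rw [abs_of_nonneg hp0]
    have hpm0 : 0 ≤ p ^ (m - 1) := Real.rpow_nonneg hp0 _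
    rcases le_or_gt b 0 with hb0' | hb0'
    · have h1 := mul_nonneg hrm0 (neg_nonneg.2 hb0')
      have h2 := mul_nonneg hpm0 ha0.le
      have h3 := mul_nonneg hPm hcΩ
      linarith
    · have hqe : upwindDiff h w W x = (W x - W (x - h)) / h := by
        unfold upwindDiff
        rw [if_neg (not_le.2 hb0')]
      have hq : r ≤ p + c / h := by
        refine max_le (by positivity) ((min_le_left _ _).trans ?_)
        rw [hqe, hp, ← add_div]
        exact div_le_div_of_nonneg_right (by linarith) hh.le
      have h1 := mul_le_mul_of_nonneg_right (hlip hp0 hr0 hrP hq) ha0.le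
      have h2 := mul_le_mul_of_nonneg_left hba hrm0
      have h3 := mul_le_mul_of_nonneg_right hrm hcΩ
      have h4 : (m - 1) * P ^ (m - 2) * (c / h) * a ≤ (m - 1) * P ^ (m - 2) * (c / h) * A :=
        mul_le_mul_of_nonneg_left hA2 (by positivity)
      linarith

/-- Slope and size bounds under which `scheme_comparison` applies to `V` at every point. -/
structure SlopeBounds (h : ℝ) (w : ℤ → ℝ) (M P A : ℝ) (V : ℝ → ℝ) : Prop where
  mono : Monotone V
  bounded : ∀ x, |V x| ≤ M
  slope : ∀ x, V (x + h) - V x ≤ P * h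
  lap : ∀ x, |discFracLap h w V x| ≤ A

/-- The time step restriction under which the scheme is monotone on functions with slopes in
`[0, P]` and with discrete fractional Laplacian at most `A`. -/
def TimeStepBound (m h τ : ℝ) (w : ℤ → ℝ) (P A : ℝ) : Prop :=
  τ * ((m - 1) * P ^ (m - 2) * A / h + P ^ (m - 1) * ∑' k, puncture w k) ≤ 1

section Step

variable {m h τ P A M : ℝ} {w : ℤ → ℝ}

theorem SlopeBounds.comparison {B' : ℝ} {V W : ℝ → ℝ} (hV : SlopeBounds h w M P A V)
    (hw : AdmissibleWeights w) (hm : 2 ≤ m) (hh : 0 < h) (hτ : 0 < τ) (hP : 0 ≤ P)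
    (hcfl : TimeStepBound m h τ w P A) (hW : ∀ x, |W x| ≤ B') (hVW : ∀ x, V x ≤ W x) (x : ℝ) :
    V x + τ * discOp m h w V x ≤
      W x - τ * (max 0 (min (upwindDiff h w W x) P) ^ (m - 1) * discFracLap h w W x) := by
  exact scheme_comparison hw hm hh hτ hP hV.bounded hW hVW x (hV.mono (by linarith))
    (hV.slope x) (hV.mono (by linarith)) (hV.lap x) hcfl

/-- Two functions with slopes in `[0, P]`: no cut-off is needed. -/
theorem SlopeBounds.comparison_of_slope {B' : ℝ} {V W : ℝ → ℝ} (hV : SlopeBounds h w M P A V)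
    (hw : AdmissibleWeights w) (hm : 2 ≤ m) (hh : 0 < h) (hτ : 0 < τ) (hP : 0 ≤ P)
    (hcfl : TimeStepBound m h τ w P A) (hW : ∀ x, |W x| ≤ B') (hWmono : Monotone W)
    (hWslope : ∀ x, W (x + h) - W x ≤ P * h) (hVW : ∀ x, V x ≤ W x) (x : ℝ) :
    V x + τ * discOp m h w V x ≤ W x + τ * discOp m h w W x := by
  have h1 := hV.comparison hw hm hh hτ hP hcfl hW hVW x
  have h2 : 0 ≤ upwindDiff h w W x ∧ upwindDiff h w W x ≤ P := by
    unfold upwindDiff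
    have e1 := hWmono (show x ≤ x + h by linarith)
    have e2 := hWmono (show x - h ≤ x by linarith)
    have e3 := hWslope (x - h)
    rw [sub_add_cancel] at e3
    split_ifs
    · exact ⟨div_nonneg (by linarith) hh.le, (div_le_iff₀ hh).2 (hWslope x)⟩
    · exact ⟨div_nonneg (by linarith) hh.le, (div_le_iff₀ hh).2 e3⟩
  rw [min_eq_left h2.2, max_eq_right h2.1] at h1
  simp only [discOp]
  rw [abs_of_nonneg h2.1]
  simp only [discOp] at h1
  linarith

theorem SlopeBounds.step_mono {V : ℝ → ℝ} (hV : SlopeBounds h w M P A V)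
    (hw : AdmissibleWeights w) (hm : 2 ≤ m) (hh : 0 < h) (hτ : 0 < τ) (hP : 0 ≤ P)
    (hcfl : TimeStepBound m h τ w P A) :
    Monotone fun x => V x + τ * discOp m h w V x := by
  intro x y hxy
  have := hV.comparison_of_slope hw hm hh hτ hP hcfl (W := fun z => V (z + (y - x)))
    (fun z => hV.bounded _) (fun a b hab => hV.mono (by linarith))
    (fun z => by simpa only [add_right_comm] using hV.slope (z + (y - x)))
    (fun z => hV.mono (by linarith)) x
  simpa [discOp_translate] using this

theorem SlopeBounds.step_lipschitz {V : ℝ → ℝ} (hV : SlopeBounds h w M P A V)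
    (hw : AdmissibleWeights w) (hm : 2 ≤ m) (hh : 0 < h) (hτ : 0 < τ) (hP : 0 ≤ P)
    (hcfl : TimeStepBound m h τ w P A) {L : ℝ} (hL : ∀ x y, x ≤ y → V y - V x ≤ L * (y - x))
    {x y : ℝ} (hxy : x ≤ y) :
    (V y + τ * discOp m h w V y) - (V x + τ * discOp m h w V x) ≤ L * (y - x) := by
  -- Compare the translate of `V` by `y - x` with `V + L (y - x)`.
  have hT : SlopeBounds h w M P A fun z => V (z + (y - x)) :=
    ⟨fun a b hab => hV.mono (by linarith), fun z => hV.bounded _,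
      fun z => by simpa only [add_right_comm] using hV.slope (z + (y - x)),
      fun z => by simpa only [discFracLap_translate] using hV.lap (z + (y - x))⟩
  have := hT.comparison_of_slope hw hm hh hτ hP hcfl (W := fun z => V z + L * (y - x))
    (B' := M + |L * (y - x)|)
    (fun z => (abs_add_le _ _).trans (by gcongr; exact hV.bounded z))
    (fun a b hab => by simpa using hV.mono hab)
    (fun z => by simpa using hV.slope z)
    (fun z => by have := hL z (z + (y - x)) (by linarith); ring_nf at this ⊢; linarith) x
  simp only [discOp_translate, discOp_add_const, add_sub_cancel] at this
  linarith

theorem SlopeBounds.step_bounded {V : ℝ → ℝ} (hV : SlopeBounds h w M P A V)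
    (hw : AdmissibleWeights w) (hm : 2 ≤ m) (hh : 0 < h) (hτ : 0 < τ) (hP : 0 ≤ P)
    (hcfl : TimeStepBound m h τ w P A) (x : ℝ) : |V x + τ * discOp m h w V x| ≤ M := by
  have hc : ∀ c : ℝ, SlopeBounds h w |c| P A fun _ => c := fun c =>
    ⟨monotone_const, fun _ => le_rfl, fun _ => by simpa using mul_nonneg hP hh.le,
      fun x => by simpa [discFracLap_const] using (abs_nonneg _).trans (hV.lap x)⟩
  have h1 := (hc (-M)).comparison_of_slope hw hm hh hτ hP hcfl hV.bounded hV.mono hV.slope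
    (fun z => (abs_le.1 (hV.bounded z)).1) x
  have h2 := hV.comparison_of_slope hw hm hh hτ hP hcfl (hc M).bounded (hc M).mono (hc M).slope
    (fun z => (abs_le.1 (hV.bounded z)).2) x
  rw [discOp_const] at h1 h2
  rw [abs_le]
  constructor <;> linarith

end Step

/-! ### Bounds on the iterates under the CFL conditions -/

/-- A second difference of a monotone function is a difference of two increments of equal sign, so
it obeys the same bound as each of them (without a factor `2`). -/
theorem abs_second_diff_le_of_monotone {V : ℝ → ℝ} (hV : Monotone V) {x y b : ℝ}
    (hb : ∀ a c, a ≤ c → c - a = |y| → V c - V a ≤ b) :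
    |2 * V x - V (x + y) - V (x - y)| ≤ b := by
  rw [abs_le]
  rcases le_total 0 y with hy | hy
  · have h1 := hV (show x ≤ x + y by linarith)
    have h2 := hV (show x - y ≤ x by linarith)
    have h3 := hb x (x + y) (by linarith) (by rw [abs_of_nonneg hy]; ring)
    have h4 := hb (x - y) x (by linarith) (by rw [abs_of_nonneg hy]; ring)
    constructor <;> linarith
  · have h1 := hV (show x + y ≤ x by linarith)
    have h2 := hV (show x ≤ x - y by linarith)
    have h3 := hb (x + y) x (by linarith) (by rw [abs_of_nonpos hy]; ring)
    have h4 := hb x (x - y) (by linarith) (by rw [abs_of_nonpos hy]; ring)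
    constructor <;> linarith

section Bounded

variable {m h τ M : ℝ} {w : ℤ → ℝ}

theorem slopeBounds_of_bounded (hw : AdmissibleWeights w) (hh : 0 < h) {V : ℝ → ℝ}
    (hmono : Monotone V) (hV : ∀ x, |V x| ≤ M) :
    SlopeBounds h w M (2 * M / h) (2 * M * ∑' k, puncture w k) V := by
  have hM : 0 ≤ M := (abs_nonneg _).trans (hV 0)
  have hosc : ∀ a c, V c - V a ≤ 2 * M := fun a c => by
    have := abs_le.1 (hV a)
    have := abs_le.1 (hV c)
    linarith
  refine ⟨hmono, hV, fun x => ?_, fun x => ?_⟩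
  · rw [div_mul_cancel₀ _ hh.ne']
    exact hosc _ _
  · have h1 := hw.abs_discFracLap_le h hV x (b := fun _ => 2 * M)
      (fun k => abs_second_diff_le_of_monotone hmono fun a c _ _ => hosc a c)
      (hw.puncture_summable.mul_left _)
    rw [tsum_mul_left] at h1
    have := mul_nonneg hM hw.total_nonneg
    linarith

theorem timeStepBound_of_CFL1 {s Cs : ℝ} (hm : 2 ≤ m) (hM : 0 ≤ M) (hh : 0 < h) (hτ : 0 < τ)
    (hwt : WeightBounds s Cs h w) (hcfl : CFL1 s m Cs M h τ) :
    TimeStepBound m h τ w (2 * M / h) (2 * M * ∑' k, puncture w k) := by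
  have hΩ := hwt.total
  rw [tsum_puncture] at hΩ
  unfold TimeStepBound
  unfold CFL1 at hcfl
  set Ω := ∑' k, puncture w k
  have e1 : (2 * M / h) ^ (m - 1) = (2 * M / h) ^ (m - 2) * (2 * M / h) := by
    rw [← Real.rpow_add_one' (by positivity) (by linarith)]
    ring_nf
  have e2 : τ * ((m - 1) * (2 * M / h) ^ (m - 2) * (2 * M * Ω) / h + (2 * M / h) ^ (m - 1) * Ω)
      = τ * m * (2 * M / h) ^ (m - 1) * Ω := by
    rw [e1]
    ring
  have e3 : h ^ (2 * s + m - 1) = h ^ (2 * s) * h ^ (m - 1) := by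
    rw [← Real.rpow_add hh]
    ring_nf
  have h1 : 0 < h ^ (2 * s) := Real.rpow_pos_of_pos hh _
  have h2 : 0 < h ^ (m - 1) := Real.rpow_pos_of_pos hh _
  have h3 : 0 ≤ τ * m * (2 * M / h) ^ (m - 1) := by positivity
  calc _ = τ * m * (2 * M / h) ^ (m - 1) * Ω := e2
    _ ≤ τ * m * (2 * M / h) ^ (m - 1) * (Cs * h ^ (-(2 * s))) := by gcongr
    _ = (Cs * m * (2 * M) ^ (m - 1) * τ) / h ^ (2 * s + m - 1) := by
        rw [e3, Real.div_rpow (by positivity) hh.le, Real.rpow_neg hh.le]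
        field_simp
    _ ≤ 1 := (div_le_one (by positivity)).2 hcfl

end Bounded

/-- The growth rate in `h` of the first absolute moment of the weights near the origin. -/
def nearScale (s h : ℝ) : ℝ :=
  open scoped Classical in
  if 1 / 2 < s then h ^ (1 - 2 * s) else if s = 1 / 2 then |Real.log h| else 1

/-- The quantity `h^{max(2s,1)} f_s(h)` bounding the time step for Lipschitz data. -/
def stepScale (s h : ℝ) : ℝ :=
  open scoped Classical in
  h ^ (max (2 * s) 1) * (if s = 1 / 2 then 1 / |Real.log h| else 1)

section Scales

variable {s h : ℝ}

theorem one_le_abs_log (hh : 0 < h) (hh1 : h ≤ Real.exp (-1)) : 1 ≤ |Real.log h| := by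
  have := Real.log_le_log hh hh1
  rw [Real.log_exp] at this
  rw [abs_of_nonpos (by linarith)]
  linarith

theorem le_one_of_le_exp (hh1 : h ≤ Real.exp (-1)) : h ≤ 1 :=
  hh1.trans (Real.exp_le_one_iff.2 (by norm_num))

theorem one_le_nearScale (hh : 0 < h) (hh1 : h ≤ Real.exp (-1)) : 1 ≤ nearScale s h := by
  unfold nearScale
  split_ifs with h1 h2
  · exact Real.one_le_rpow_of_pos_of_le_one_of_nonpos hh (le_one_of_le_exp hh1) (by linarith)
  · exact one_le_abs_log hh hh1
  · exact le_rfl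

theorem stepScale_pos (hh : 0 < h) (hh1 : h ≤ Real.exp (-1)) : 0 < stepScale s h := by
  have := one_le_abs_log hh hh1
  unfold stepScale
  have := Real.rpow_pos_of_pos hh (max (2 * s) 1)
  split_ifs <;> positivity

theorem stepScale_le (hh : 0 < h) (hh1 : h ≤ Real.exp (-1)) : stepScale s h ≤ h := by
  have h1 := one_le_abs_log hh hh1
  have h2 : h ^ (max (2 * s) 1) ≤ h := by
    simpa using Real.rpow_le_rpow_of_exponent_ge hh (le_one_of_le_exp hh1) (le_max_right (2 * s) 1)
  have h3 := Real.rpow_pos_of_pos hh (max (2 * s) 1)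
  unfold stepScale
  split_ifs
  · have : 1 / |Real.log h| ≤ 1 := (div_le_one (by linarith)).2 h1
    nlinarith
  · linarith

theorem nearScale_mul_stepScale (hh : 0 < h) (hh1 : h ≤ Real.exp (-1)) :
    nearScale s h / h * stepScale s h = 1 := by
  have h1 := one_le_abs_log hh hh1
  have h1' : |Real.log h| ≠ 0 := by linarith
  unfold nearScale stepScale
  split_ifs with a b c
  · linarith
  · rw [max_eq_left (by linarith), Real.rpow_sub hh, Real.rpow_one]
    have := Real.rpow_pos_of_pos hh (2 * s)
    field_simp
  · rw [max_eq_right (by linarith), Real.rpow_one]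
    field_simp
  · rw [max_eq_right (by linarith), Real.rpow_one]
    field_simp

theorem rpow_mul_stepScale_le (hh : 0 < h) (hh1 : h ≤ Real.exp (-1)) :
    h ^ (-(2 * s)) * stepScale s h ≤ 1 := by
  have h1 := one_le_abs_log hh hh1
  have h2 : h ^ (-(2 * s)) * h ^ (max (2 * s) 1) ≤ 1 := by
    rw [← Real.rpow_add hh]
    refine Real.rpow_le_one hh.le (le_one_of_le_exp hh1) ?_
    linarith [le_max_left (2 * s) 1]
  have h3 : 0 ≤ h ^ (-(2 * s)) * h ^ (max (2 * s) 1) := by positivity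
  unfold stepScale
  rw [← mul_assoc]
  split_ifs
  · have : 1 / |Real.log h| ≤ 1 := (div_le_one (by linarith)).2 h1
    exact mul_le_one₀ h2 (by positivity) this
  · linarith

end Scales

section Lipschitz

variable {s m h τ M L Cs : ℝ} {w : ℤ → ℝ}

/-- The bound `min (L |y|) (2 M)` on increments of a function, up to constants, in the form
matching the two moment bounds on the weights. -/
def incrementBound (L M y : ℝ) : ℝ := if |y| ≤ 1 then L * |y| else 2 * M

theorem incrementBound_eq (L M h : ℝ) (w : ℤ → ℝ) (k : ℤ) :
    incrementBound L M (k * h) * puncture w k =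
      L * ({k : ℤ | 0 < |(k : ℝ) * h| ∧ |(k : ℝ) * h| ≤ 1}.indicator
        (fun k : ℤ => |h * (k : ℝ)| * w k) k) +
      2 * M * ({k : ℤ | 1 < |(k : ℝ) * h|}.indicator w k) := by
  unfold incrementBound puncture
  by_cases hk : k = 0
  · simp [hk]
  by_cases h1 : |(k : ℝ) * h| ≤ 1
  · by_cases h0 : 0 < |(k : ℝ) * h|
    · simp only [indicator, mem_ofPred_eq, h1, h0, hk, not_lt.2 h1, and_self, if_true, if_false,
        mul_zero, add_zero]
      rw [mul_comm h]
      ring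
    · have : |(k : ℝ) * h| = 0 := le_antisymm (not_lt.1 h0) (abs_nonneg _)
      simp only [indicator, mem_ofPred_eq, this]
      norm_num
  · simp only [indicator, mem_ofPred_eq, h1, hk, not_le.1 h1, and_false, if_true, if_false,
      mul_zero, zero_add]

theorem incrementBound_tsum_le (hw : AdmissibleWeights w) (hwt : WeightBounds s Cs h w)
    (hL : 0 ≤ L) (hM : 0 ≤ M) :
    (Summable fun k : ℤ => incrementBound L M (k * h) * puncture w k) ∧
      ∑' k : ℤ, incrementBound L M (k * h) * puncture w k ≤
        L * (Cs * nearScale s h) + 2 * M * Cs := by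
  have h1 : Summable fun k : ℤ => {k : ℤ | 0 < |(k : ℝ) * h| ∧ |(k : ℝ) * h| ≤ 1}.indicator
        (fun k : ℤ => |h * (k : ℝ)| * w k) k := by
    refine Summable.of_nonneg_of_le (fun k => ?_) (fun k => ?_) hw.puncture_summable
    · exact indicator_nonneg (fun k _ => mul_nonneg (abs_nonneg _) (hw.nonneg k)) k
    · refine indicator_le' (fun k hk => ?_) (fun k _ => hw.puncture_nonneg k) k
      have hk0 : k ≠ 0 := by
        rintro rfl
        simp at hk
      rw [puncture, if_neg hk0, mul_comm h]
      exact mul_le_of_le_one_left (hw.nonneg k) hk.2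
  have h2 : Summable fun k : ℤ => {k : ℤ | 1 < |(k : ℝ) * h|}.indicator w k := by
    refine Summable.of_nonneg_of_le (fun k => ?_) (fun k => ?_) hw.puncture_summable
    · exact indicator_nonneg (fun k _ => hw.nonneg k) k
    · refine indicator_le' (fun k hk => ?_) (fun k _ => hw.puncture_nonneg k) k
      have hk0 : k ≠ 0 := by
        rintro rfl
        simp at hk
        linarith
      rw [puncture, if_neg hk0]
  simp only [incrementBound_eq]
  refine ⟨(h1.mul_left _).add (h2.mul_left _), ?_⟩
  rw [(h1.mul_left _).tsum_add (h2.mul_left _), tsum_mul_left, tsum_mul_left,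
    ← tsum_subtype, ← tsum_subtype]
  exact add_le_add (mul_le_mul_of_nonneg_left hwt.near hL)
    (mul_le_mul_of_nonneg_left hwt.far (by positivity))

theorem slopeBounds_of_lipschitz (hw : AdmissibleWeights w) (hwt : WeightBounds s Cs h w)
    (hCs : 0 < Cs) (hh : 0 < h) (hh1 : h ≤ Real.exp (-1)) (hL : 0 ≤ L) {V : ℝ → ℝ}
    (hmono : Monotone V) (hV : ∀ x, |V x| ≤ M)
    (hlip : ∀ x y, x ≤ y → V y - V x ≤ L * (y - x)) :
    SlopeBounds h w M L (max L (2 * M) * (Cs * nearScale s h)) V := by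
  have hM : 0 ≤ M := (abs_nonneg _).trans (hV 0)
  refine ⟨hmono, hV, fun x => ?_, fun x => ?_⟩
  · simpa using hlip x (x + h) (by linarith)
  · obtain ⟨hsum, hle⟩ := incrementBound_tsum_le hw hwt hL hM
    have h1 := hw.abs_discFracLap_le h hV x (b := fun k => incrementBound L M (k * h))
      (fun k => abs_second_diff_le_of_monotone hmono fun a c hac he => by
        unfold incrementBound
        split_ifs
        · rw [← he]
          exact hlip a c hac
        · have := abs_le.1 (hV a)
          have := abs_le.1 (hV c)
          linarith) hsum
    have h2 : L * (Cs * nearScale s h) ≤ max L (2 * M) * (Cs * nearScale s h) := by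
      have := one_le_nearScale (s := s) hh hh1
      exact mul_le_mul_of_nonneg_right (le_max_left _ _) (by positivity)
    have h3 : 2 * M * Cs ≤ max L (2 * M) * (Cs * nearScale s h) := by
      have := one_le_nearScale (s := s) hh hh1
      refine mul_le_mul (le_max_right _ _) ?_ hCs.le (hL.trans (le_max_left _ _))
      exact le_mul_of_one_le_right hCs.le this
    linarith

theorem timeStepBound_of_CFL2 (hm : 2 ≤ m) (hL : 0 ≤ L) (hCs : 0 < Cs) (hh : 0 < h)
    (hh1 : h ≤ Real.exp (-1)) (hτ : 0 < τ) (hwt : WeightBounds s Cs h w)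
    (hcfl : CFL2 s m Cs M L h τ) :
    TimeStepBound m h τ w L (max L (2 * M) * (Cs * nearScale s h)) := by
  have hΩ := hwt.total
  rw [tsum_puncture] at hΩ
  have hμ := stepScale_pos (s := s) hh hh1
  have h1 := nearScale_mul_stepScale (s := s) hh hh1
  have h2 := rpow_mul_stepScale_le (s := s) hh hh1
  have hcfl : Cs * m * L ^ (m - 2) * max L (2 * M) * τ ≤ stepScale s h := hcfl
  unfold TimeStepBound
  set Ω := ∑' k, puncture w k
  set Λ := max L (2 * M)
  set g := nearScale s h
  set μ := stepScale s h
  have hΛ : 0 ≤ Λ := hL.trans (le_max_left _ _)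
  have hLm : 0 ≤ L ^ (m - 2) := Real.rpow_nonneg hL _
  have e1 : L ^ (m - 1) ≤ L ^ (m - 2) * Λ := by
    rw [show m - 1 = (m - 2) + 1 by ring, Real.rpow_add_one' hL (by linarith)]
    exact mul_le_mul_of_nonneg_left (le_max_left _ _) hLm
  have e2 : Ω ≤ Cs * (1 / μ) := hΩ.trans (by
    gcongr
    rwa [le_div_iff₀ hμ])
  have e3 : g / h = 1 / μ := by rw [eq_div_iff hμ.ne']; exact h1
  have hm1 : 0 ≤ m - 1 := by linarith
  calc τ * ((m - 1) * L ^ (m - 2) * (Λ * (Cs * g)) / h + L ^ (m - 1) * Ω)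
      = τ * ((m - 1) * L ^ (m - 2) * Λ * Cs * (g / h) + L ^ (m - 1) * Ω) := by ring
    _ ≤ τ * ((m - 1) * L ^ (m - 2) * Λ * Cs * (1 / μ) + L ^ (m - 2) * Λ * (Cs * (1 / μ))) := by
        have e4 : L ^ (m - 1) * Ω ≤ L ^ (m - 2) * Λ * (Cs * (1 / μ)) :=
          (mul_le_mul_of_nonneg_left e2 (Real.rpow_nonneg hL _)).trans
            (mul_le_mul_of_nonneg_right e1 (by positivity))
        rw [e3]
        exact mul_le_mul_of_nonneg_left (by linarith) hτ.le
    _ = (Cs * m * L ^ (m - 2) * Λ * τ) / μ := by ring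
    _ ≤ 1 := (div_le_one hμ).2 hcfl

end Lipschitz

/-- Bounds for all iterates with grid size `h`, time step `τ` and weights `w`, together with the
time step restriction they require. -/
def StableScheme (m h τ : ℝ) (w : ℤ → ℝ) (M : ℝ) (v₀ : ℝ → ℝ) : Prop :=
  ∃ P A : ℝ, 0 ≤ P ∧ TimeStepBound m h τ w P A ∧
    ∀ j, SlopeBounds h w M P A (schemeIter m h τ w v₀ j)

section Stability

variable {s m h τ M L Cs : ℝ} {w : ℤ → ℝ} {v₀ : ℝ → ℝ}

theorem stableScheme_of_CFL1 (hw : AdmissibleWeights w) (hwt : WeightBounds s Cs h w)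
    (hm : 2 ≤ m) (hh : 0 < h) (hτ : 0 < τ) (hmono : Monotone v₀) (hbdd : ∀ x, |v₀ x| ≤ M)
    (hcfl : CFL1 s m Cs M h τ) : StableScheme m h τ w M v₀ := by
  have hM : 0 ≤ M := (abs_nonneg _).trans (hbdd 0)
  have hP : 0 ≤ 2 * M / h := by positivity
  have hts := timeStepBound_of_CFL1 hm hM hh hτ hwt hcfl
  refine ⟨_, _, hP, hts, fun j => ?_⟩
  induction j with
  | zero => exact slopeBounds_of_bounded hw hh hmono hbdd
  | succ j ih =>
    exact slopeBounds_of_bounded hw hh (ih.step_mono hw hm hh hτ hP hts)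
      (ih.step_bounded hw hm hh hτ hP hts)

theorem stableScheme_of_CFL2 (hw : AdmissibleWeights w) (hwt : WeightBounds s Cs h w)
    (hm : 2 ≤ m) (hL : 0 ≤ L) (hCs : 0 < Cs) (hh : 0 < h) (hh1 : h ≤ Real.exp (-1))
    (hτ : 0 < τ) (hmono : Monotone v₀) (hbdd : ∀ x, |v₀ x| ≤ M)
    (hlip : ∀ x y, |v₀ x - v₀ y| ≤ L * |x - y|)
    (hcfl : CFL2 s m Cs M L h τ) : StableScheme m h τ w M v₀ := by
  have hts := timeStepBound_of_CFL2 hm hL hCs hh hh1 hτ hwt hcfl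
  refine ⟨_, _, hL, hts, fun j => ?_⟩
  suffices H : SlopeBounds h w M L (max L (2 * M) * (Cs * nearScale s h))
      (schemeIter m h τ w v₀ j) ∧ ∀ x y, x ≤ y →
        schemeIter m h τ w v₀ j y - schemeIter m h τ w v₀ j x ≤ L * (y - x) from H.1
  induction j with
  | zero =>
    have hlip' : ∀ x y, x ≤ y → v₀ y - v₀ x ≤ L * (y - x) := fun x y hxy => by
      have := hlip y x
      rw [abs_of_nonneg (sub_nonneg.2 hxy)] at this
      exact (le_abs_self _).trans this
    exact ⟨slopeBounds_of_lipschitz hw hwt hCs hh hh1 hL hmono hbdd hlip', hlip'⟩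
  | succ j ih =>
    have hl : ∀ x y, x ≤ y → schemeIter m h τ w v₀ (j + 1) y - schemeIter m h τ w v₀ (j + 1) x
        ≤ L * (y - x) := fun x y hxy =>
      ih.1.step_lipschitz hw hm hh hτ hL hts ih.2 hxy
    exact ⟨slopeBounds_of_lipschitz hw hwt hCs hh hh1 hL (ih.1.step_mono hw hm hh hτ hL hts)
      (ih.1.step_bounded hw hm hh hτ hL hts) hl, hl⟩

theorem schemeIter_const (m h τ : ℝ) (w : ℤ → ℝ) (c : ℝ) (j : ℕ) :
    schemeIter m h τ w (fun _ => c) j = fun _ => c := by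
  induction j with
  | zero => rfl
  | succ j ih =>
    funext x
    simp [schemeIter, ih, discOp_const]

theorem stableScheme_const (hm : 2 ≤ m) (c : ℝ) (hc : |c| ≤ M) :
    StableScheme m h τ w M fun _ => c := by
  refine ⟨0, 0, le_rfl, ?_, fun j => ?_⟩
  · simp [TimeStepBound, Real.zero_rpow (show m - 1 ≠ 0 by linarith)]
  · rw [schemeIter_const]
    exact ⟨monotone_const, fun _ => hc, fun _ => by simp, fun x => by simp [discFracLap_const]⟩

end Stability

/-! ### A bump with small fractional Laplacian, and consequences of consistency -/

section Bump

/-- A smooth bounded profile, vanishing to second order at the origin and tending to `1` at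
distances large compared with `R`. -/
def bump (R y : ℝ) : ℝ := y ^ 2 / (R ^ 2 + y ^ 2)

variable {R : ℝ}

theorem bump_zero (R : ℝ) : bump R 0 = 0 := by simp [bump]

theorem bump_nonneg (R y : ℝ) : 0 ≤ bump R y := by unfold bump; positivity

theorem bump_le_one (R y : ℝ) : bump R y ≤ 1 := by
  unfold bump
  refine div_le_one_of_le₀ ?_ (by positivity)
  nlinarith [sq_nonneg R]

theorem abs_bump_le (R y : ℝ) : |bump R y| ≤ 1 := by
  rw [abs_of_nonneg (bump_nonneg R y)]
  exact bump_le_one R y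

theorem bump_pos (hR : 0 < R) {y : ℝ} (hy : y ≠ 0) : 0 < bump R y := by
  unfold bump
  positivity

theorem half_le_bump (hR : 0 < R) {y : ℝ} (hy : R ≤ |y|) : 1 / 2 ≤ bump R y := by
  unfold bump
  have : R ^ 2 ≤ y ^ 2 := by
    rw [← sq_abs y]
    gcongr
  rw [div_le_div_iff₀ two_pos (by positivity)]
  linarith

theorem bump_contDiff (hR : 0 < R) : ContDiff ℝ 2 (bump R) := by
  unfold bump
  exact (contDiff_id.pow 2).div (contDiff_const.add (contDiff_id.pow 2)) fun y => by positivity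

theorem bump_anti {R' y : ℝ} (hR : 0 < R) (hRR' : R ≤ R') : bump R' y ≤ bump R y := by
  unfold bump
  gcongr

theorem bump_tendsto_zero (y : ℝ) : Tendsto (fun R => bump R y) atTop (𝓝 0) := by
  unfold bump
  exact tendsto_const_nhds.div_atTop
    (tendsto_atTop_add_const_right _ _ (tendsto_pow_atTop two_ne_zero))

open MeasureTheory

theorem bump_one_kernel_integrable {s : ℝ} (hs : s ∈ Ioo (0 : ℝ) 1) :
    Integrable fun y : ℝ => bump 1 y / |y| ^ (1 + 2 * s) := by
  obtain ⟨hs0, hs1⟩ := hs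
  have hmeas : Measurable fun y : ℝ => bump 1 y / |y| ^ (1 + 2 * s) := by
    unfold bump
    fun_prop
  have hpos : IntegrableOn (fun y : ℝ => bump 1 y / |y| ^ (1 + 2 * s)) (Ioi 0) := by
    rw [← Ioc_union_Ioi_eq_Ioi zero_le_one]
    refine IntegrableOn.union ?_ ?_
    · have h1 : IntegrableOn (fun y : ℝ => y ^ (1 - 2 * s)) (Ioc 0 1) :=
        (intervalIntegral.intervalIntegrable_rpow' (by linarith)).1
      refine h1.mono' hmeas.aestronglyMeasurable ?_
      refine (ae_restrict_iff' measurableSet_Ioc).2 (Eventually.of_forall fun y hy => ?_)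
      have hy0 : 0 < y := hy.1
      rw [Real.norm_of_nonneg (div_nonneg (bump_nonneg _ _) (by positivity)), abs_of_pos hy0,
        div_le_iff₀ (by positivity), ← Real.rpow_add hy0]
      ring_nf
      unfold bump
      rw [div_le_iff₀ (by positivity)]
      norm_num
      nlinarith [sq_nonneg y]
    · have h1 : IntegrableOn (fun y : ℝ => y ^ (-(1 + 2 * s))) (Ioi 1) :=
        integrableOn_Ioi_rpow_of_lt (by linarith) one_pos
      refine h1.mono' hmeas.aestronglyMeasurable ?_
      refine (ae_restrict_iff' measurableSet_Ioi).2 (Eventually.of_forall fun y hy => ?_)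
      have hy0 : 0 < y := one_pos.trans hy
      rw [Real.norm_of_nonneg (div_nonneg (bump_nonneg _ _) (by positivity)), abs_of_pos hy0,
        div_le_iff₀ (by positivity), ← Real.rpow_add hy0]
      simpa using bump_le_one 1 y
  have hneg : IntegrableOn (fun y : ℝ => bump 1 y / |y| ^ (1 + 2 * s)) (Iio 0) := by
    have := hpos.comp_neg
    simpa [bump] using this
  rw [← integrableOn_univ, ← Iio_union_Ici (a := (0 : ℝ))]
  exact hneg.union ((integrableOn_Ici_iff_integrableOn_Ioi).2 hpos)

theorem bump_kernel_integrable {s : ℝ} (hs : s ∈ Ioo (0 : ℝ) 1) (hR : 1 ≤ R) :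
    Integrable fun y : ℝ => bump R y / |y| ^ (1 + 2 * s) := by
  have hmeas : Measurable fun y : ℝ => bump R y / |y| ^ (1 + 2 * s) := by
    unfold bump
    fun_prop
  refine (bump_one_kernel_integrable hs).mono' hmeas.aestronglyMeasurable
    (Eventually.of_forall fun y => ?_)
  rw [Real.norm_of_nonneg (div_nonneg (bump_nonneg _ _) (by positivity))]
  exact div_le_div_of_nonneg_right (bump_anti one_pos hR) (by positivity)

/-- The integrals over `ε < |y|` of an integrable function tend to the full integral. -/
theorem tendsto_integral_abs_gt {f : ℝ → ℝ} (hf : Integrable f) :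
    Tendsto (fun ε : ℝ => ∫ y in {y : ℝ | ε < |y|}, f y) (𝓝[>] 0) (𝓝 (∫ y, f y)) := by
  have hms : ∀ ε : ℝ, MeasurableSet {y : ℝ | ε < |y|} := fun ε =>
    measurableSet_lt measurable_const measurable_norm
  simp only [← integral_indicator (hms _)]
  refine tendsto_integral_filter_of_dominated_convergence (fun y => ‖f y‖)
    (Eventually.of_forall fun ε => hf.aestronglyMeasurable.indicator (hms ε))
    (Eventually.of_forall fun ε => Eventually.of_forall fun y =>
      norm_indicator_le_norm_self f y) hf.norm ?_
  have h0 : ∀ᵐ y : ℝ, y ≠ 0 := by simp [ae_iff]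
  filter_upwards [h0] with y hy
  refine tendsto_const_nhds.congr' ?_
  have : ∀ᶠ ε : ℝ in 𝓝[>] 0, ε < |y| :=
    (eventually_lt_nhds (abs_pos.2 hy)).filter_mono nhdsWithin_le_nhds
  filter_upwards [this] with ε hε
  exact (indicator_of_mem (s := {y : ℝ | ε < |y|}) hε f).symm

/-- The fractional Laplacian of the wide profile, at its centre, tends to zero: the tails of the
kernel are integrable. -/
theorem fracLap_bump_tendsto {s : ℝ} (hs : s ∈ Ioo (0 : ℝ) 1) (x₀ : ℝ) :
    Tendsto (fun R => fracLap s (fun y => bump R (y - x₀)) x₀) atTop (𝓝 0) := by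
  have key : Tendsto (fun R => ∫ y : ℝ, bump R y / |y| ^ (1 + 2 * s)) atTop (𝓝 0) := by
    have : Tendsto (fun R => ∫ y : ℝ, bump R y / |y| ^ (1 + 2 * s)) atTop
        (𝓝 (∫ y : ℝ, 0 / |y| ^ (1 + 2 * s))) := by
      refine tendsto_integral_filter_of_dominated_convergence
        (fun y : ℝ => bump 1 y / |y| ^ (1 + 2 * s)) ?_ ?_ (bump_one_kernel_integrable hs)
        (Eventually.of_forall fun y => (bump_tendsto_zero y).div_const _)
      · filter_upwards [eventually_ge_atTop 1] with R hR
        exact (bump_kernel_integrable hs hR).aestronglyMeasurable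
      · filter_upwards [eventually_ge_atTop 1] with R hR
        refine Eventually.of_forall fun y => ?_
        rw [Real.norm_of_nonneg (div_nonneg (bump_nonneg _ _) (by positivity))]
        exact div_le_div_of_nonneg_right (bump_anti one_pos hR) (by positivity)
    simpa using this
  unfold fracLap
  set c := 2 ^ (2 * s) * Real.Gamma ((1 + 2 * s) / 2) / (Real.sqrt Real.pi * |Real.Gamma (-s)|)
  have h2 : Tendsto (fun R => c * -∫ y : ℝ, bump R y / |y| ^ (1 + 2 * s)) atTop (𝓝 0) := by
    simpa using key.neg.const_mul c
  refine h2.congr' ?_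
  filter_upwards [eventually_ge_atTop 1] with R hR
  congr 1
  refine (Tendsto.limUnder_eq ?_).symm
  have := (tendsto_integral_abs_gt (bump_kernel_integrable hs hR)).neg
  refine this.congr fun ε => ?_
  rw [← integral_neg]
  refine integral_congr_ae (Eventually.of_forall fun y => ?_)
  simp only [sub_self, bump_zero, add_sub_cancel_left, zero_sub, neg_div]

end Bump

section Consistency

variable {s : ℝ} {ω : ℝ → ℤ → ℝ}

theorem discFracLap_continuous {h : ℝ} {w : ℤ → ℝ} (hw : AdmissibleWeights w) {φ : ℝ → ℝ} {B : ℝ}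
    (hφ : Continuous φ) (hB : ∀ x, |φ x| ≤ B) : Continuous (discFracLap h w φ) := by
  rw [show discFracLap h w φ = fun x => ∑' k : ℤ, (φ x - φ (x + k * h)) * puncture w k from
    funext (discFracLap_eq h w φ)]
  refine continuous_tsum (fun k => by fun_prop) (hw.puncture_summable.mul_left (B + B)) fun k x => ?_
  rw [Real.norm_eq_abs, abs_mul, abs_of_nonneg (hw.puncture_nonneg k)]
  exact mul_le_mul_of_nonneg_right ((abs_sub _ _).trans (add_le_add (hB _) (hB _)))
    (hw.puncture_nonneg k)

theorem ConsistentWeights.tendsto (hcons : ConsistentWeights s ω)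
    (hadm : ∀ᶠ h in 𝓝[>] (0 : ℝ), AdmissibleWeights (ω h)) {φ : ℝ → ℝ} {B : ℝ}
    (hφ : ContDiff ℝ 2 φ) (hB : ∀ x, |φ x| ≤ B) (x₀ : ℝ) :
    Tendsto (fun q : ℝ × ℝ => discFracLap q.1 (ω q.1) φ q.2) (𝓝[>] 0 ×ˢ 𝓝 x₀)
      (𝓝 (fracLap s φ x₀)) := by
  have hl := hcons φ hφ ⟨B, hB⟩
  have hc : Continuous (fracLap s φ) :=
    hl.continuous (hadm.mono fun h hw => discFracLap_continuous hw hφ.continuous hB).frequently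
  have h1 := tendstoLocallyUniformly_iff_forall_tendsto.1 hl x₀
  have h2 : Tendsto (fun q : ℝ × ℝ => fracLap s φ q.2) (𝓝[>] 0 ×ˢ 𝓝 x₀) (𝓝 (fracLap s φ x₀)) :=
    (hc.tendsto x₀).comp tendsto_snd
  exact h2.congr_uniformity h1

theorem ConsistentWeights.tendsto_at (hcons : ConsistentWeights s ω)
    (hadm : ∀ᶠ h in 𝓝[>] (0 : ℝ), AdmissibleWeights (ω h)) {φ : ℝ → ℝ} {B : ℝ}
    (hφ : ContDiff ℝ 2 φ) (hB : ∀ x, |φ x| ≤ B) (x₀ : ℝ) :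
    Tendsto (fun h => discFracLap h (ω h) φ x₀) (𝓝[>] 0) (𝓝 (fracLap s φ x₀)) :=
  (hcons.tendsto hadm hφ hB x₀).comp (tendsto_id.prodMk tendsto_const_nhds)

theorem ConsistentWeights.fracLap_add (hcons : ConsistentWeights s ω)
    (hadm : ∀ᶠ h in 𝓝[>] (0 : ℝ), AdmissibleWeights (ω h)) {φ ψ : ℝ → ℝ} {B B' : ℝ}
    (hφ : ContDiff ℝ 2 φ) (hB : ∀ x, |φ x| ≤ B) (hψ : ContDiff ℝ 2 ψ) (hB' : ∀ x, |ψ x| ≤ B')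
    (x : ℝ) : fracLap s (fun y => φ y + ψ y) x = fracLap s φ x + fracLap s ψ x := by
  refine tendsto_nhds_unique (hcons.tendsto_at hadm (B := B + B') (hφ.add hψ)
    (fun y => (abs_add_le _ _).trans (add_le_add (hB y) (hB' y))) x)
    (((hcons.tendsto_at hadm hφ hB x).add (hcons.tendsto_at hadm hψ hB' x)).congr' ?_)
  filter_upwards [hadm] with h hw
  exact (hw.discFracLap_add h hB hB' x).symm

theorem ConsistentWeights.fracLap_const_mul (hcons : ConsistentWeights s ω)
    (hadm : ∀ᶠ h in 𝓝[>] (0 : ℝ), AdmissibleWeights (ω h)) {φ : ℝ → ℝ} {B : ℝ}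
    (hφ : ContDiff ℝ 2 φ) (hB : ∀ x, |φ x| ≤ B) (c x : ℝ) :
    fracLap s (fun y => c * φ y) x = c * fracLap s φ x := by
  refine tendsto_nhds_unique (hcons.tendsto_at hadm (B := |c| * B) (contDiff_const.mul hφ)
    (fun y => by rw [abs_mul]; exact mul_le_mul_of_nonneg_left (hB y) (abs_nonneg c)) x)
    (((hcons.tendsto_at hadm hφ hB x).const_mul c).congr fun h => ?_)
  exact (discFracLap_const_mul h _ φ c x).symm

theorem ConsistentWeights.fracLap_reflect (hcons : ConsistentWeights s ω)
    (hadm : ∀ᶠ h in 𝓝[>] (0 : ℝ), AdmissibleWeights (ω h)) {φ : ℝ → ℝ} {B : ℝ}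
    (hφ : ContDiff ℝ 2 φ) (hB : ∀ x, |φ x| ≤ B) (x : ℝ) :
    fracLap s (fun y => -φ (-y)) x = -fracLap s φ (-x) := by
  refine tendsto_nhds_unique (hcons.tendsto_at hadm (B := B) (hφ.comp contDiff_neg).neg
    (fun y => by simpa using hB (-y)) x)
    ((hcons.tendsto_at hadm hφ hB (-x)).neg.congr' ?_)
  filter_upwards [hadm] with h hw
  exact (discFracLap_reflect hw.symm h φ x).symm

end Consistency

/-! ### Test functions on a strip -/

theorem abs_second_diff_le {u g k : ℝ → ℝ} {x y r κ : ℝ} (hu : ∀ z, HasDerivAt u (g z) z)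
    (hg : ∀ z, HasDerivAt g (k z) z) (hk : ∀ z ∈ Icc (x - r) (x + r), |k z| ≤ κ) (hy : |y| ≤ r) :
    |2 * u x - u (x + y) - u (x - y)| ≤ 2 * κ * y ^ 2 := by
  have hg' : ∀ z ∈ Icc (-|y|) |y|, ‖g (x + z) - g (x - z)‖ ≤ κ * (2 * |y|) := by
    intro z hz
    have hz' : |z| ≤ |y| := abs_le.2 hz
    have hκ : 0 ≤ κ := (abs_nonneg _).trans (hk x ⟨by linarith [abs_nonneg y], by
      linarith [abs_nonneg y]⟩)
    have h1 := (convex_Icc (x - r) (x + r)).norm_image_sub_le_of_norm_hasDerivWithin_le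
      (f := g) (f' := k) (x := x - z) (y := x + z) (C := κ)
      (fun z _ => (hg z).hasDerivWithinAt) hk
      ⟨by linarith [hz.2], by linarith [hz.1]⟩ ⟨by linarith [hz.1], by linarith [hz.2]⟩
    refine h1.trans (mul_le_mul_of_nonneg_left ?_ hκ)
    rw [show x + z - (x - z) = 2 * z by ring, Real.norm_eq_abs, abs_mul, abs_two]
    linarith
  have hU : ∀ z ∈ Icc (-|y|) |y|, HasDerivWithinAt (fun z => u (x + z) + u (x - z))
      (g (x + z) - g (x - z)) (Icc (-|y|) |y|) z := by
    intro z _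
    have h1 : HasDerivAt (fun z => u (x + z)) (g (x + z)) z := (hu (x + z)).comp_const_add x z
    have h2 : HasDerivAt (fun z => u (x - z)) (-g (x - z)) z := (hu (x - z)).comp_const_sub x z
    have := (h1.fun_add h2).hasDerivWithinAt (s := Icc (-|y|) |y|)
    simpa only [← sub_eq_add_neg] using this
  have h1 := (convex_Icc (-|y|) |y|).norm_image_sub_le_of_norm_hasDerivWithin_le hU hg'
    (x := 0) (y := y) ⟨by simp, by simp⟩ ⟨neg_abs_le y, le_abs_self y⟩
  simp only [add_zero, sub_zero, Real.norm_eq_abs] at h1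
  rw [show κ * (2 * |y|) * |y| = 2 * κ * (|y| * |y|) by ring, abs_mul_abs_self, ← pow_two] at h1
  rw [← abs_neg]
  convert h1 using 2
  ring

/-- The strip `ℝ × [α, β]`. -/
def strip (α β : ℝ) : Set (ℝ × ℝ) := univ ×ˢ Icc α β

section Strip

variable {α β : ℝ}

theorem mem_strip {p : ℝ × ℝ} : p ∈ strip α β ↔ p.2 ∈ Icc α β := by simp [strip]

theorem strip_convex : Convex ℝ (strip α β) := convex_univ.prod (convex_Icc α β)

theorem strip_uniqueDiffOn (h : α < β) : UniqueDiffOn ℝ (strip α β) :=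
  uniqueDiffOn_univ.prod (uniqueDiffOn_Icc h)

theorem hasDerivAt_slice {f : ℝ × ℝ → ℝ} (hf : DifferentiableOn ℝ f (strip α β)) {t : ℝ}
    (ht : t ∈ Icc α β) (x : ℝ) :
    HasDerivAt (fun y => f (y, t)) (fderivWithin ℝ f (strip α β) (x, t) (1, 0)) x := by
  have h1 : HasFDerivWithinAt f _ (strip α β) (x, t) :=
    (hf (x, t) (mem_strip.2 ht)).hasFDerivWithinAt
  have h2 : HasDerivWithinAt (fun y : ℝ => (y, t)) ((1 : ℝ), (0 : ℝ)) univ x :=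
    ((hasDerivAt_id x).prodMk (hasDerivAt_const x t)).hasDerivWithinAt
  exact (h1.comp_hasDerivWithinAt x h2 fun y _ => mem_strip.2 ht).hasDerivAt univ_mem

theorem hasDerivWithinAt_slice {f : ℝ × ℝ → ℝ} (hf : DifferentiableOn ℝ f (strip α β)) {t : ℝ}
    (ht : t ∈ Icc α β) (x : ℝ) :
    HasDerivWithinAt (fun r => f (x, r)) (fderivWithin ℝ f (strip α β) (x, t) (0, 1))
      (Icc α β) t := by
  have h1 : HasFDerivWithinAt f _ (strip α β) (x, t) :=
    (hf (x, t) (mem_strip.2 ht)).hasFDerivWithinAt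
  have h2 : HasDerivWithinAt (fun r : ℝ => (x, r)) ((0 : ℝ), (1 : ℝ)) (Icc α β) t :=
    ((hasDerivAt_const t x).prodMk (hasDerivAt_id t)).hasDerivWithinAt
  exact h1.comp_hasDerivWithinAt t h2 fun r hr => mem_strip.2 hr

theorem contDiff_slice {f : ℝ × ℝ → ℝ} {n : WithTop ℕ∞} (hf : ContDiffOn ℝ n f (strip α β)) {t : ℝ}
    (ht : t ∈ Icc α β) : ContDiff ℝ n fun y => f (y, t) := by
  rw [← contDiffOn_univ]
  exact hf.comp (contDiff_id.prodMk contDiff_const).contDiffOn fun y _ => mem_strip.2 ht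

/-- A `C¹` function on the strip is strictly differentiable relative to the strip. -/
theorem strip_strict_diff {f : ℝ × ℝ → ℝ} (hαβ : α < β) (hf : ContDiffOn ℝ 1 f (strip α β))
    {p : ℝ × ℝ} (hp : p ∈ strip α β) {ε : ℝ} (hε : 0 < ε) :
    ∃ δ > 0, ∀ q ∈ strip α β, ∀ q' ∈ strip α β, dist q p < δ → dist q' p < δ →
      |f q' - f q - fderivWithin ℝ f (strip α β) p (q' - q)| ≤ ε * ‖q' - q‖ := by
  have hc := hf.continuousOn_fderivWithin (strip_uniqueDiffOn hαβ) le_rfl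
  obtain ⟨δ, hδ, H⟩ := Metric.continuousWithinAt_iff.1 (hc p hp) ε hε
  refine ⟨δ, hδ, fun q hq q' hq' hqd hqd' => ?_⟩
  have hd := hf.differentiableOn one_ne_zero
  refine ((strip_convex (α := α) (β := β)).inter
    (convex_ball p δ)).norm_image_sub_le_of_norm_hasFDerivWithin_le'
    (f := f) (f' := fderivWithin ℝ f (strip α β)) (fun z hz => ?_) (fun z hz => ?_)
    ⟨hq, hqd⟩ ⟨hq', hqd'⟩
  · exact ((hd z hz.1).hasFDerivWithinAt).mono inter_subset_left
  · rw [← dist_eq_norm]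
    exact (H hz.1 hz.2).le

/-- Difference quotients in a fixed direction `e` converge to the directional derivative, jointly
in the base point and the increment. -/
theorem strip_tendsto_quotient {f : ℝ × ℝ → ℝ} (hαβ : α < β) (hf : ContDiffOn ℝ 1 f (strip α β))
    {p : ℝ × ℝ} (hp : p ∈ strip α β) (e : ℝ × ℝ) {ι : Type*} {F : Filter ι} {q : ι → ℝ × ℝ}
    {a : ι → ℝ} (hq : Tendsto q F (𝓝 p)) (ha : Tendsto a F (𝓝 0)) (ha0 : ∀ᶠ i in F, a i ≠ 0)
    (hqs : ∀ᶠ i in F, q i ∈ strip α β) (hqs' : ∀ᶠ i in F, q i + a i • e ∈ strip α β) :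
    Tendsto (fun i => (f (q i + a i • e) - f (q i)) / a i) F
      (𝓝 (fderivWithin ℝ f (strip α β) p e)) := by
  have hq' : Tendsto (fun i => q i + a i • e) F (𝓝 p) := by
    simpa using hq.add (ha.smul_const e)
  rw [Metric.tendsto_nhds]
  intro ε hε
  obtain ⟨δ, hδ, H⟩ := strip_strict_diff hαβ hf hp (ε := ε / (2 * (‖e‖ + 1))) (by positivity)
  filter_upwards [Metric.tendsto_nhds.1 hq δ hδ, Metric.tendsto_nhds.1 hq' δ hδ, ha0, hqs, hqs']
    with i h1 h2 h3 h4 h5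
  have h6 := H _ h4 _ h5 h1 h2
  rw [add_sub_cancel_left, map_smul, norm_smul, smul_eq_mul, Real.norm_eq_abs] at h6
  rw [Real.dist_eq, show (f (q i + a i • e) - f (q i)) / a i - fderivWithin ℝ f (strip α β) p e
    = (f (q i + a i • e) - f (q i) - a i * fderivWithin ℝ f (strip α β) p e) / a i by
      field_simp, abs_div, div_lt_iff₀ (abs_pos.2 h3)]
  refine h6.trans_lt ?_
  have h7 : 0 < |a i| := abs_pos.2 h3
  rw [div_mul_eq_mul_div, div_lt_iff₀ (by positivity)]
  have : 0 ≤ ‖e‖ := norm_nonneg e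
  nlinarith [mul_pos hε h7, mul_nonneg (mul_nonneg hε.le h7.le) this]

variable {s : ℝ} {ω : ℝ → ℤ → ℝ}

/-- The discrete fractional Laplacians of the time slices of a `C²` function converge, jointly in
the grid size, the point and the time. -/
theorem ConsistentWeights.tendsto_slice (hcons : ConsistentWeights s ω)
    (hadm : ∀ᶠ h in 𝓝[>] (0 : ℝ), AdmissibleWeights (ω h)) (hs : s ∈ Ioo (0 : ℝ) 1)
    (hαβ : α < β) {φ : ℝ × ℝ → ℝ} {B : ℝ} (hφ : ContDiffOn ℝ 2 φ (strip α β))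
    (hB : ∀ p ∈ strip α β, |φ p| ≤ B) {x₀ t₀ : ℝ} (ht₀ : t₀ ∈ Icc α β) :
    Tendsto (fun q : ℝ × (ℝ × ℝ) => discFracLap q.1 (ω q.1) (fun y => φ (y, q.2.2)) q.2.1)
      (𝓝[>] 0 ×ˢ (𝓝 x₀ ×ˢ 𝓝[Icc α β] t₀)) (𝓝 (fracLap s (fun y => φ (y, t₀)) x₀)) := by
  set K := strip α β
  have hφd : DifferentiableOn ℝ φ K := hφ.differentiableOn two_ne_zero
  set g : ℝ × ℝ → ℝ := fun p => fderivWithin ℝ φ K p (1, 0) with hg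
  have hgC : ContDiffOn ℝ 1 g K :=
    (hφ.fderivWithin (strip_uniqueDiffOn hαβ) (by norm_num)).clm_apply contDiffOn_const
  set k : ℝ × ℝ → ℝ := fun p => fderivWithin ℝ g K p (1, 0) with hk
  have hkC : ContinuousOn k K :=
    (hgC.continuousOn_fderivWithin (strip_uniqueDiffOn hαβ) le_rfl).clm_apply continuousOn_const
  have hgd : DifferentiableOn ℝ g K := hgC.differentiableOn one_ne_zero
  have hB0 : 0 ≤ B := (abs_nonneg _).trans (hB (x₀, t₀) (mem_strip.2 ht₀))
  have hBt : ∀ t ∈ Icc α β, ∀ y, |φ (y, t)| ≤ B := fun t ht y => hB _ (mem_strip.2 ht)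
  have hφ₀ : ContDiff ℝ 2 fun y => φ (y, t₀) := contDiff_slice hφ ht₀
  -- The slice at the limiting time is covered by consistency.
  have hmain : Tendsto (fun q : ℝ × (ℝ × ℝ) =>
      discFracLap q.1 (ω q.1) (fun y => φ (y, t₀)) q.2.1)
      (𝓝[>] 0 ×ˢ (𝓝 x₀ ×ˢ 𝓝[Icc α β] t₀)) (𝓝 (fracLap s (fun y => φ (y, t₀)) x₀)) :=
    (hcons.tendsto hadm hφ₀ (hBt t₀ ht₀) x₀).comp
      (tendsto_fst.prodMk (tendsto_fst.comp tendsto_snd))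
  -- The difference of the slices is small: near the point by its second derivative, far from it
  -- because the weights have uniformly small tails.
  have hdiff : Tendsto (fun q : ℝ × (ℝ × ℝ) =>
      discFracLap q.1 (ω q.1) (fun y => φ (y, q.2.2) + -1 * φ (y, t₀)) q.2.1)
      (𝓝[>] 0 ×ˢ (𝓝 x₀ ×ˢ 𝓝[Icc α β] t₀)) (𝓝 0) := by
    rw [Metric.tendsto_nhds]
    intro ε hε
    have hbump : ∀ R : ℝ, 0 < R → Tendsto (fun h => discFracLap h (ω h) (bump R) 0) (𝓝[>] 0)
        (𝓝 (fracLap s (bump R) 0)) := fun R hR =>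
      hcons.tendsto_at hadm (bump_contDiff hR) (abs_bump_le R) 0
    obtain ⟨R, hR, hR1⟩ : ∃ R : ℝ, |fracLap s (bump R) 0| < ε / (32 * (B + 1)) ∧ 1 ≤ R := by
      have h0 := fracLap_bump_tendsto hs 0
      simp only [sub_zero] at h0
      have h1 := (Metric.tendsto_nhds.1 h0 (ε / (32 * (B + 1))) (by positivity)).and
        (eventually_ge_atTop 1)
      obtain ⟨R, h2, h3⟩ := h1.exists
      exact ⟨R, by simpa using h2, h3⟩
    have hR0 : 0 < R := by linarith
    set η := |fracLap s (bump 1) 0| + 1 with hη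
    have hη0 : 0 < η := by positivity
    set κ := ε / (4 * (1 + R ^ 2) * η) with hκ
    have hκ0 : 0 < κ := by positivity
    -- uniform continuity of the second derivative on a compact set
    have hcomp : IsCompact (Icc (x₀ - (R + 1)) (x₀ + (R + 1)) ×ˢ Icc α β) :=
      isCompact_Icc.prod isCompact_Icc
    have hunif := hcomp.uniformContinuousOn_of_continuous
      (hkC.mono fun p hp => mem_strip.2 hp.2)
    obtain ⟨δ, hδ, Hδ⟩ := Metric.uniformContinuousOn_iff.1 hunif κ hκ0
    have ev1 : ∀ᶠ h in 𝓝[>] (0 : ℝ), |discFracLap h (ω h) (bump R) 0| < ε / (32 * (B + 1)) :=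
      (hbump R hR0).abs.eventually_lt_const hR
    have ev2 : ∀ᶠ h in 𝓝[>] (0 : ℝ), |discFracLap h (ω h) (bump 1) 0| < η :=
      (hbump 1 one_pos).abs.eventually_lt_const (by rw [hη]; linarith)
    have ev3 : ∀ᶠ x in 𝓝 x₀, x ∈ Icc (x₀ - 1) (x₀ + 1) :=
      Icc_mem_nhds (by linarith) (by linarith)
    have ev4 : ∀ᶠ t in 𝓝[Icc α β] t₀, t ∈ Icc α β ∧ dist t t₀ < δ :=
      (eventually_mem_nhdsWithin).and
        ((Metric.eventually_nhds_iff.2 ⟨δ, hδ, fun _ h => h⟩).filter_mono nhdsWithin_le_nhds)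
    have evh := (hadm.and (ev1.and ev2)).prod_mk (ev3.prod_mk ev4)
    refine evh.mono ?_
    rintro ⟨h, x, t⟩ ⟨⟨hw, hh1, hh2⟩, hx, ht, htδ⟩
    simp only at hw hh1 hh2 hx ht htδ ⊢
    have hψB : ∀ y, |φ (y, t) + -1 * φ (y, t₀)| ≤ 2 * B := fun y => by
      have h1 := abs_le.1 (hBt t ht y)
      have h2 := abs_le.1 (hBt t₀ ht₀ y)
      rw [abs_le]
      constructor <;> linarith
    have hsec : ∀ y, |2 * (φ (x, t) + -1 * φ (x, t₀)) - (φ (x + y, t) + -1 * φ (x + y, t₀)) -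
        (φ (x - y, t) + -1 * φ (x - y, t₀))| ≤
        2 * κ * (1 + R ^ 2) * bump 1 y + 16 * B * bump R y := by
      intro y
      have hb1 := bump_nonneg 1 y
      have hbR := bump_nonneg R y
      rcases le_total |y| R with hy | hy
      · have h1 := abs_second_diff_le (x := x) (y := y) (r := R) (κ := κ)
          (u := fun z => φ (z, t) + -1 * φ (z, t₀)) (g := fun z => g (z, t) + -1 * g (z, t₀))
          (k := fun z => k (z, t) + -1 * k (z, t₀))
          (fun z => (hasDerivAt_slice hφd ht z).fun_add ((hasDerivAt_slice hφd ht₀ z).const_mul _))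
          (fun z => (hasDerivAt_slice hgd ht z).fun_add ((hasDerivAt_slice hgd ht₀ z).const_mul _))
          (fun z hz => by
            have hz' : z ∈ Icc (x₀ - (R + 1)) (x₀ + (R + 1)) :=
              ⟨by linarith [hz.1, hx.1], by linarith [hz.2, hx.2]⟩
            have := Hδ (z, t) ⟨hz', ht⟩ (z, t₀) ⟨hz', ht₀⟩ (by
              rw [Prod.dist_eq]
              simpa using htδ)
            rw [Real.dist_eq] at this
            rw [neg_one_mul, ← sub_eq_add_neg]
            exact this.le) hy
        refine h1.trans ?_
        have h2 : y ^ 2 ≤ (1 + R ^ 2) * bump 1 y := by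
          unfold bump
          rw [mul_div_assoc', le_div_iff₀ (by positivity)]
          have : y ^ 2 ≤ R ^ 2 := by
            rw [← sq_abs y]
            gcongr
          nlinarith [sq_nonneg y]
        have h3 : 2 * κ * y ^ 2 ≤ 2 * κ * ((1 + R ^ 2) * bump 1 y) := by gcongr
        have h4 : 0 ≤ 16 * B * bump R y := by positivity
        linarith
      · have h1 := half_le_bump hR0 hy
        have h2 : 8 * B ≤ 16 * B * bump R y := by nlinarith
        have h3 : 0 ≤ 2 * κ * (1 + R ^ 2) * bump 1 y := by positivity
        have a1 := abs_le.1 (hψB x)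
        have a2 := abs_le.1 (hψB (x + y))
        have a3 := abs_le.1 (hψB (x - y))
        rw [abs_le]
        constructor <;> linarith
    have hsum1 : Summable fun j : ℤ => bump 1 (j * h) * puncture (ω h) j :=
      hw.summable_mul fun j => abs_bump_le 1 _
    have hsumR : Summable fun j : ℤ => bump R (j * h) * puncture (ω h) j :=
      hw.summable_mul fun j => abs_bump_le R _
    have hval : ∀ R, ∑' j : ℤ, bump R (j * h) * puncture (ω h) j =
        -discFracLap h (ω h) (bump R) 0 := fun R => by
      rw [discFracLap_eq, ← tsum_neg]
      exact tsum_congr fun j => by simp [bump_zero]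
    have hsplit : (fun j : ℤ => (2 * κ * (1 + R ^ 2) * bump 1 (j * h) +
        16 * B * bump R (j * h)) * puncture (ω h) j) =
        fun j : ℤ => 2 * κ * (1 + R ^ 2) * (bump 1 (j * h) * puncture (ω h) j) +
          16 * B * (bump R (j * h) * puncture (ω h) j) := by
      funext j
      ring
    have hle := hw.abs_discFracLap_le h hψB x (fun j => hsec (j * h))
      (by rw [hsplit]; exact (hsum1.mul_left _).add (hsumR.mul_left _))
    rw [hsplit, (hsum1.mul_left _).tsum_add (hsumR.mul_left _), tsum_mul_left, tsum_mul_left,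
      hval, hval] at hle
    rw [Real.dist_eq, sub_zero]
    refine hle.trans_lt ?_
    have e1 : 2 * κ * (1 + R ^ 2) * -discFracLap h (ω h) (bump 1) 0 ≤ 2 * κ * (1 + R ^ 2) * η :=
      mul_le_mul_of_nonneg_left ((neg_le_abs _).trans hh2.le) (by positivity)
    have e2 : 2 * κ * (1 + R ^ 2) * η = ε / 2 := by
      rw [hκ]
      field_simp
      norm_num
    have e3 : 16 * B * -discFracLap h (ω h) (bump R) 0 ≤ 16 * B * (ε / (32 * (B + 1))) :=
      mul_le_mul_of_nonneg_left ((neg_le_abs _).trans hh1.le) (by positivity)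
    have e4 : 16 * B * (ε / (32 * (B + 1))) ≤ ε / 2 := by
      rw [mul_div_assoc', div_le_div_iff₀ (by positivity) two_pos]
      nlinarith
    linarith
  have hsum := hmain.add hdiff
  rw [add_zero] at hsum
  refine hsum.congr' ?_
  have ev : ∀ᶠ q : ℝ × (ℝ × ℝ) in 𝓝[>] 0 ×ˢ (𝓝 x₀ ×ˢ 𝓝[Icc α β] t₀),
      AdmissibleWeights (ω q.1) ∧ True ∧ q.2.2 ∈ Icc α β :=
    hadm.prod_mk ((Eventually.of_forall fun _ => trivial).prod_mk eventually_mem_nhdsWithin)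
  filter_upwards [ev] with q hq
  obtain ⟨hw, -, ht⟩ := hq
  rw [← hw.discFracLap_add q.1 (hBt t₀ ht₀) (B' := 2 * B) (fun y => by
    have h1 := abs_le.1 (hBt _ ht y)
    have h2 := abs_le.1 (hBt t₀ ht₀ y)
    rw [abs_le]
    constructor <;> linarith)]
  congr 1
  funext y
  ring

end Strip

/-! ### Relaxed limits and approximate maximum points -/

section RelaxedLimit

variable {T M : ℝ} {V : ℝ → ℝ × ℝ → ℝ} {p : ℝ × ℝ}

theorem relaxed_neBot (hp : p ∈ closedCyl T) :
    (𝓝[>] (0 : ℝ) ×ˢ 𝓝[closedCyl T] p).NeBot := by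
  have : (𝓝[closedCyl T] p).NeBot := mem_closure_iff_nhdsWithin_neBot.1 (subset_closure hp)
  infer_instance

theorem relaxed_eventually_abs_le (hV : ∀ᶠ h in 𝓝[>] (0 : ℝ), ∀ q, |V h q| ≤ M) (p : ℝ × ℝ) :
    ∀ᶠ q : ℝ × (ℝ × ℝ) in 𝓝[>] (0 : ℝ) ×ˢ 𝓝[closedCyl T] p, |V q.1 q.2| ≤ M :=
  (hV.prod_inl _).mono fun q hq => hq q.2

theorem relaxed_isBoundedUnder_le (hV : ∀ᶠ h in 𝓝[>] (0 : ℝ), ∀ q, |V h q| ≤ M) (p : ℝ × ℝ) :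
    IsBoundedUnder (· ≤ ·) (𝓝[>] (0 : ℝ) ×ˢ 𝓝[closedCyl T] p)
      fun q : ℝ × (ℝ × ℝ) => V q.1 q.2 :=
  isBoundedUnder_of_eventually_le
    ((relaxed_eventually_abs_le hV p).mono fun _ hq => (abs_le.1 hq).2)

theorem relaxed_isCoboundedUnder_le (hV : ∀ᶠ h in 𝓝[>] (0 : ℝ), ∀ q, |V h q| ≤ M)
    (hp : p ∈ closedCyl T) :
    IsCoboundedUnder (· ≤ ·) (𝓝[>] (0 : ℝ) ×ˢ 𝓝[closedCyl T] p)
      fun q : ℝ × (ℝ × ℝ) => V q.1 q.2 := by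
  have := relaxed_neBot hp
  exact (isBoundedUnder_of_eventually_ge
    ((relaxed_eventually_abs_le hV p).mono fun _ hq => (abs_le.1 hq).1)).isCoboundedUnder_le

theorem abs_upperRelaxedLimit_le (hV : ∀ᶠ h in 𝓝[>] (0 : ℝ), ∀ q, |V h q| ≤ M)
    (hp : p ∈ closedCyl T) : |upperRelaxedLimit T V p| ≤ M := by
  have := relaxed_neBot hp
  have hb := relaxed_eventually_abs_le (T := T) hV p
  rw [abs_le]
  constructor
  · exact le_limsup_of_frequently_le (hb.mono fun _ hq => (abs_le.1 hq).1).frequently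
      (relaxed_isBoundedUnder_le hV p)
  · exact limsup_le_of_le (relaxed_isCoboundedUnder_le hV hp)
      (hb.mono fun _ hq => (abs_le.1 hq).2)

theorem upperRelaxedLimit_usc (hV : ∀ᶠ h in 𝓝[>] (0 : ℝ), ∀ q, |V h q| ≤ M) :
    UpperSemicontinuousOn (upperRelaxedLimit T V) (closedCyl T) := by
  intro p hp y hy
  obtain ⟨z, hz, hzy⟩ := exists_between hy
  have h1 := eventually_lt_of_limsup_lt hz (relaxed_isBoundedUnder_le hV p)
  obtain ⟨pa, ha, pb, hb, H⟩ := eventually_prod_iff.1 h1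
  filter_upwards [eventually_eventually_nhdsWithin.2 hb, self_mem_nhdsWithin] with p' hp' hpC
  refine lt_of_le_of_lt (limsup_le_of_le (relaxed_isCoboundedUnder_le hV hpC) ?_) hzy
  exact eventually_prod_iff.2 ⟨pa, ha, pb, hp', fun hx _ hy => (H hx hy).le⟩

end RelaxedLimit

theorem exists_approx_max {X : Type*} {K : Set X} {f : X → ℝ} {B ε : ℝ} (hf : ∀ q ∈ K, f q ≤ B)
    (hε : 0 < ε) {q₁ : X} (hq₁ : q₁ ∈ K) :
    ∃ q ∈ K, f q₁ ≤ f q ∧ ∀ q' ∈ K, f q' ≤ f q + ε := by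
  have hbdd : BddAbove (f '' K) := ⟨B, by rintro _ ⟨q, hq, rfl⟩; exact hf q hq⟩
  obtain ⟨_, ⟨q, hq, rfl⟩, hlt⟩ := exists_lt_of_lt_csSup
    (⟨_, mem_image_of_mem f hq₁⟩ : (f '' K).Nonempty) (show sSup (f '' K) - ε < sSup (f '' K) by
      linarith)
  have hle : ∀ q' ∈ K, f q' ≤ sSup (f '' K) := fun q' hq' =>
    le_csSup hbdd (mem_image_of_mem f hq')
  rcases le_total (f q₁) (f q) with h | h
  · exact ⟨q, hq, h, fun q' hq' => by linarith [hle q' hq']⟩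
  · exact ⟨q₁, hq₁, le_rfl, fun q' hq' => by linarith [hle q' hq']⟩

/-- A strict maximum point of `v̄ - φ` on a strip, where `v̄` is the upper relaxed limit of `V_h`
and `φ` is large at spatial infinity, is a limit of approximate maximum points of `V_h - φ`, along
which moreover `V_h` does not drop below `v̄`. As the `V_h` need not be upper semicontinuous,
maximum points themselves need not exist. -/
theorem frequently_approx_max {T M B R α β : ℝ} {V : ℝ → ℝ × ℝ → ℝ}
    (hV : ∀ᶠ h in 𝓝[>] (0 : ℝ), ∀ q, |V h q| ≤ M) (hK : strip α β ⊆ closedCyl T) {p₀ : ℝ × ℝ}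
    (hp₀ : p₀ ∈ strip α β) (hKn : strip α β ∈ 𝓝[closedCyl T] p₀) {φ : ℝ × ℝ → ℝ}
    (hφ : ContinuousOn φ (strip α β)) (hB : ∀ p ∈ strip α β, |φ p| ≤ B)
    (hmax : ∀ p ∈ strip α β, p ≠ p₀ →
      upperRelaxedLimit T V p - φ p < upperRelaxedLimit T V p₀ - φ p₀)
    (hfar : ∀ p ∈ strip α β, R ≤ |p.1 - p₀.1| →
      M - φ p ≤ upperRelaxedLimit T V p₀ - φ p₀ - 1)
    {ε : ℝ → ℝ} (hε : ∀ᶠ h in 𝓝[>] (0 : ℝ), 0 < ε h) {η : ℝ} (hη : 0 < η) :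
    ∃ᶠ q in 𝓝[>] (0 : ℝ) ×ˢ 𝓝[strip α β] p₀, upperRelaxedLimit T V p₀ - η < V q.1 q.2 ∧
      ∀ q' ∈ strip α β, V q.1 q' - φ q' ≤ V q.1 q.2 - φ q.2 + ε q.1 := by
  intro hcon
  set K := strip α β with hKdef
  set v := upperRelaxedLimit T V with hv
  obtain ⟨pa, ha, pb, hb, H⟩ := eventually_prod_iff.1 hcon
  have hN : ∀ᶠ q in 𝓝[K] p₀, pb q ∧ φ p₀ - η / 2 < φ q :=
    hb.and ((hφ p₀ hp₀).eventually_const_lt (by linarith))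
  obtain ⟨U, hU, hp₀U, hUN⟩ := mem_nhdsWithin.1 hN
  have hC : IsCompact ((Icc (p₀.1 - R) (p₀.1 + R) ×ˢ Icc α β) \ U) :=
    (isCompact_Icc.prod isCompact_Icc).diff hU
  have hCK : (Icc (p₀.1 - R) (p₀.1 + R) ×ˢ Icc α β) \ U ⊆ K := fun p hp =>
    mem_strip.2 hp.1.2
  -- Away from `p₀` the functions `V_h - φ` stay uniformly below the maximum.
  have hcl : ∃ η₁ > 0, ∀ᶠ h in 𝓝[>] (0 : ℝ),
      ∀ q ∈ (Icc (p₀.1 - R) (p₀.1 + R) ×ˢ Icc α β) \ U, V h q - φ q ≤ v p₀ - φ p₀ - η₁ := by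
    refine hC.induction_on (p := fun S => ∃ η₁ > 0, ∀ᶠ h in 𝓝[>] (0 : ℝ),
      ∀ q ∈ S, V h q - φ q ≤ v p₀ - φ p₀ - η₁) ⟨1, one_pos, by simp⟩ ?_ ?_ ?_
    · rintro S S' hSS' ⟨η₁, h1, h2⟩
      exact ⟨η₁, h1, h2.mono fun h hh q hq => hh q (hSS' hq)⟩
    · rintro S S' ⟨η₁, h1, h2⟩ ⟨η₂, h3, h4⟩
      refine ⟨min η₁ η₂, lt_min h1 h3, ?_⟩
      filter_upwards [h2, h4] with h h5 h6 q hq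
      rcases hq with hq | hq
      · linarith [h5 q hq, min_le_left η₁ η₂]
      · linarith [h6 q hq, min_le_right η₁ η₂]
    · intro p hp
      have hpK := hCK hp
      have hne : p ≠ p₀ := by
        rintro rfl
        exact hp.2 hp₀U
      have hlt := hmax p hpK hne
      set γ := (v p₀ - φ p₀ - (v p - φ p)) / 3 with hγ
      have hγ0 : 0 < γ := by
        rw [hγ]
        linarith
      have h1 : ∀ᶠ q : ℝ × (ℝ × ℝ) in 𝓝[>] (0 : ℝ) ×ˢ 𝓝[closedCyl T] p, V q.1 q.2 < v p + γ :=
        eventually_lt_of_limsup_lt (show upperRelaxedLimit T V p < v p + γ by linarith)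
          (relaxed_isBoundedUnder_le hV p)
      obtain ⟨qa, hqa, qb, hqb, H1⟩ := eventually_prod_iff.1 h1
      have h2 : ∀ᶠ q in 𝓝[K] p, φ p - γ < φ q :=
        (hφ p hpK).eventually_const_lt (by linarith)
      have h3 : ∀ᶠ q in 𝓝[K] p, qb q ∧ φ p - γ < φ q :=
        (hqb.filter_mono (nhdsWithin_mono p hK)).and h2
      refine ⟨_, nhdsWithin_mono p hCK h3, γ, hγ0, ?_⟩
      filter_upwards [hqa] with h hh q hq
      have h4 := H1 hh hq.1
      simp only at h4
      have h5 := hq.2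
      linarith
  obtain ⟨η₁, hη₁, hcl⟩ := hcl
  set δ := min (min η₁ 1) η / 4 with hδ
  have hδ0 : 0 < δ := by
    have : 0 < min (min η₁ 1) η := lt_min (lt_min hη₁ one_pos) hη
    positivity
  have hδ1 : 4 * δ ≤ η₁ := by
    have := (min_le_left (min η₁ 1) η).trans (min_le_left _ _)
    linarith
  have hδ2 : 4 * δ ≤ 1 := by
    have := (min_le_left (min η₁ 1) η).trans (min_le_right _ _)
    linarith
  have hδ3 : 4 * δ ≤ η := by
    have := min_le_right (min η₁ 1) η
    linarith
  have hfr : ∃ᶠ q : ℝ × (ℝ × ℝ) in 𝓝[>] (0 : ℝ) ×ˢ 𝓝[closedCyl T] p₀, v p₀ - δ < V q.1 q.2 :=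
    frequently_lt_of_lt_limsup (relaxed_isCoboundedUnder_le hV (hK hp₀))
      (show v p₀ - δ < upperRelaxedLimit T V p₀ by linarith)
  have hev1 : ∀ᶠ q in 𝓝[closedCyl T] p₀, q ∈ K ∧ φ q < φ p₀ + δ := by
    refine Eventually.and hKn ?_
    exact ((hφ p₀ hp₀).eventually_lt_const (by linarith)).filter_mono
      (nhdsWithin_le_of_mem hKn)
  have hev2 := (ha.and (hV.and (hcl.and hε))).prod_mk hev1
  obtain ⟨⟨h, q₁⟩, hq₁, ⟨hpa, hVh, hclh, hεh⟩, hq₁K, hφq₁⟩ := (hfr.and_eventually hev2).exists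
  simp only at hq₁ hpa hVh hclh hεh hq₁K hφq₁
  obtain ⟨q, hqK, hq₁q, hqmax⟩ := exists_approx_max (K := K) (f := fun q => V h q - φ q)
    (B := M + B) (fun q hq => by linarith [(abs_le.1 (hVh q)).2, (abs_le.1 (hB q hq)).1])
    hεh hq₁K
  have hnear : |q.1 - p₀.1| < R := by
    by_contra hR
    have := hfar q hqK (not_lt.1 hR)
    have := (abs_le.1 (hVh q)).2
    linarith
  have hqU : q ∈ U := by
    by_contra hqU
    have := hclh q ⟨⟨⟨by linarith [(abs_lt.1 hnear).1], by linarith [(abs_lt.1 hnear).2]⟩,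
      mem_strip.1 hqK⟩, hqU⟩
    linarith
  have hqN := hUN ⟨hqU, hqK⟩
  exact H hpa hqN.1 ⟨by have := hqN.2; simp only; linarith, hqmax⟩

section Core

variable {s m M α β : ℝ} {ω : ℝ → ℤ → ℝ} {v₀ : ℝ → ℝ} {τ : ℝ → ℝ}

/-- At an approximate maximum point of `V_h - φ` the scheme yields the discrete inequality for the
test function, with its slope cut off at the slope bound of `V_h`. -/
theorem discrete_inequality {h t P A x : ℝ} {w : ℤ → ℝ} (hw : AdmissibleWeights w) (hm : 2 ≤ m)
    (hh : 0 < h) {σ : ℝ} (hσ : 0 < σ) (hP : 0 ≤ P) (hcfl : TimeStepBound m h σ w P A)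
    (hsl : ∀ j, SlopeBounds h w M P A (schemeIter m h σ w v₀ j)) (hα : 0 ≤ α) (ht : α ≤ t - σ)
    (htβ : t ≤ β) {φ : ℝ × ℝ → ℝ} {B : ℝ} (hB : ∀ p ∈ strip α β, |φ p| ≤ B)
    (hmax : ∀ q' ∈ strip α β, extScheme m h σ w v₀ q' - φ q' ≤
      extScheme m h σ w v₀ (x, t) - φ (x, t) + σ * h) :
    (φ (x, t) - φ (x, t - σ)) / σ +
      max 0 (min (upwindDiff h w (fun y => φ (y, t - σ)) x) P) ^ (m - 1) *
        discFracLap h w (fun y => φ (y, t - σ)) x ≤ h := by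
  have hK : ∀ y, (y, t - σ) ∈ strip α β := fun y => mem_strip.2 ⟨ht, by simp only; linarith⟩
  have h0 := extScheme_step m h σ w v₀ x (t - σ) hσ (hα.trans ht)
  rw [sub_add_cancel, div_eq_iff hσ.ne'] at h0
  set ξ := extScheme m h σ w v₀ (x, t) - φ (x, t) + σ * h with hξ
  have h1 := (hsl ⌊(t - σ) / σ⌋₊).comparison hw hm hh hσ hP hcfl
    (W := fun y => φ (y, t - σ) + ξ) (B' := B + |ξ|)
    (fun y => (abs_add_le _ _).trans (by gcongr; exact hB _ (hK y)))
    (fun y => by have := hmax _ (hK y); simp only [extScheme] at this ⊢; linarith) x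
  rw [upwindDiff_add_const, discFracLap_add_const] at h1
  have h2 : extScheme m h σ w v₀ (x, t) = schemeIter m h σ w v₀ ⌊(t - σ) / σ⌋₊ x +
      σ * discOp m h w (schemeIter m h σ w v₀ ⌊(t - σ) / σ⌋₊) x := by
    simp only [extScheme] at h0 ⊢
    linarith
  rw [← h2, hξ] at h1
  set Y := max 0 (min (upwindDiff h w (fun y => φ (y, t - σ)) x) P) ^ (m - 1) *
        discFracLap h w (fun y => φ (y, t - σ)) x
  rw [div_add' _ _ _ hσ.ne', div_le_iff₀ hσ]
  linarith

/-- Passage to the limit in the discrete inequality. -/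
theorem eqn_le_zero_of_frequently_approx_max (hs : s ∈ Ioo (0 : ℝ) 1) (hm : 2 ≤ m)
    (hcons : ConsistentWeights s ω) (hadm : ∀ᶠ h in 𝓝[>] (0 : ℝ), AdmissibleWeights (ω h))
    (hτpos : ∀ᶠ h in 𝓝[>] (0 : ℝ), 0 < τ h) (hτ : Tendsto τ (𝓝[>] 0) (𝓝 0))
    (hstab : ∀ᶠ h in 𝓝[>] (0 : ℝ), StableScheme m h (τ h) (ω h) M v₀)
    (hαβ : α < β) (hα : 0 ≤ α) {φ : ℝ × ℝ → ℝ} {B : ℝ} (hφ : ContDiffOn ℝ 2 φ (strip α β))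
    (hB : ∀ p ∈ strip α β, |φ p| ≤ B) {x₀ t₀ : ℝ} (ht₀ : t₀ ∈ Icc α β)
    (hfreq : ∃ᶠ q : ℝ × (ℝ × ℝ) in 𝓝[>] (0 : ℝ) ×ˢ 𝓝[strip α β] (x₀, t₀),
      α ≤ q.2.2 - τ q.1 ∧ ∀ q' ∈ strip α β,
        extScheme m q.1 (τ q.1) (ω q.1) v₀ q' - φ q' ≤
          extScheme m q.1 (τ q.1) (ω q.1) v₀ q.2 - φ q.2 + τ q.1 * q.1) :
    fderivWithin ℝ φ (strip α β) (x₀, t₀) (0, 1) +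
      |fderivWithin ℝ φ (strip α β) (x₀, t₀) (1, 0)| ^ (m - 1) *
        fracLap s (fun y => φ (y, t₀)) x₀ ≤ 0 := by
  have hne := frequently_iff_neBot.1 hfreq
  set F := (𝓝[>] (0 : ℝ) ×ˢ 𝓝[strip α β] (x₀, t₀)) ⊓
    𝓟 {q : ℝ × (ℝ × ℝ) | α ≤ q.2.2 - τ q.1 ∧ ∀ q' ∈ strip α β,
        extScheme m q.1 (τ q.1) (ω q.1) v₀ q' - φ q' ≤
          extScheme m q.1 (τ q.1) (ω q.1) v₀ q.2 - φ q.2 + τ q.1 * q.1} with hF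
  have hFle : F ≤ 𝓝[>] (0 : ℝ) ×ˢ 𝓝[strip α β] (x₀, t₀) := inf_le_left
  have hprop : ∀ᶠ q in F, α ≤ q.2.2 - τ q.1 ∧ ∀ q' ∈ strip α β,
        extScheme m q.1 (τ q.1) (ω q.1) v₀ q' - φ q' ≤
          extScheme m q.1 (τ q.1) (ω q.1) v₀ q.2 - φ q.2 + τ q.1 * q.1 :=
    mem_inf_of_right (mem_principal_self _)
  have hp₀ : (x₀, t₀) ∈ strip α β := mem_strip.2 ht₀
  have hφ1 : ContDiffOn ℝ 1 φ (strip α β) := hφ.of_le (by norm_num)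
  have hfst : Tendsto (fun q : ℝ × (ℝ × ℝ) => q.1) F (𝓝[>] 0) := tendsto_fst.mono_left hFle
  have hfst0 : Tendsto (fun q : ℝ × (ℝ × ℝ) => q.1) F (𝓝 0) := hfst.mono_right nhdsWithin_le_nhds
  have hh0 : ∀ᶠ q in F, 0 < q.1 := hfst.eventually eventually_mem_nhdsWithin
  have hsnd : Tendsto (fun q : ℝ × (ℝ × ℝ) => q.2) F (𝓝[strip α β] (x₀, t₀)) :=
    tendsto_snd.mono_left hFle
  have hsnd0 := hsnd.mono_right nhdsWithin_le_nhds
  have hmem : ∀ᶠ q in F, q.2 ∈ strip α β := hsnd.eventually eventually_mem_nhdsWithin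
  have hx : Tendsto (fun q : ℝ × (ℝ × ℝ) => q.2.1) F (𝓝 x₀) :=
    (continuous_fst.tendsto (x₀, t₀)).comp hsnd0
  have ht : Tendsto (fun q : ℝ × (ℝ × ℝ) => q.2.2) F (𝓝 t₀) :=
    (continuous_snd.tendsto (x₀, t₀)).comp hsnd0
  have hτF : Tendsto (fun q : ℝ × (ℝ × ℝ) => τ q.1) F (𝓝 0) := hτ.comp hfst
  have hτF0 : ∀ᶠ q in F, 0 < τ q.1 := hfst.eventually hτpos
  have htτ : Tendsto (fun q : ℝ × (ℝ × ℝ) => q.2.2 - τ q.1) F (𝓝 t₀) := by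
    simpa using ht.sub hτF
  have htmem : ∀ᶠ q in F, q.2.2 - τ q.1 ∈ Icc α β := by
    filter_upwards [hprop, hmem, hτF0] with q h1 h2 h3
    exact ⟨h1.1, by linarith [(mem_strip.1 h2).2]⟩
  have hq' : Tendsto (fun q : ℝ × (ℝ × ℝ) => (q.2.1, q.2.2 - τ q.1)) F (𝓝 (x₀, t₀)) :=
    hx.prodMk_nhds htτ
  have hq'mem : ∀ᶠ q in F, (q.2.1, q.2.2 - τ q.1) ∈ strip α β :=
    htmem.mono fun q h => mem_strip.2 h
  set φt := fderivWithin ℝ φ (strip α β) (x₀, t₀) (0, 1)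
  set φx := fderivWithin ℝ φ (strip α β) (x₀, t₀) (1, 0)
  have T1 : Tendsto (fun q : ℝ × (ℝ × ℝ) => (φ q.2 - φ (q.2.1, q.2.2 - τ q.1)) / τ q.1) F
      (𝓝 φt) := by
    have := strip_tendsto_quotient hαβ hφ1 hp₀ (0, 1) hq' hτF (hτF0.mono fun q h => h.ne')
      hq'mem (hmem.mono fun q h => by simpa using h)
    simpa using this
  have T2 : Tendsto (fun q : ℝ × (ℝ × ℝ) =>
      discFracLap q.1 (ω q.1) (fun y => φ (y, q.2.2 - τ q.1)) q.2.1) F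
      (𝓝 (fracLap s (fun y => φ (y, t₀)) x₀)) :=
    (hcons.tendsto_slice hadm hs hαβ hφ hB ht₀).comp
      (hfst.prodMk (hx.prodMk (tendsto_nhdsWithin_iff.2 ⟨htτ, htmem⟩)))
  -- forward and backward differences, at times tending to `t₀`
  have hfwd : ∀ θ : ℝ × (ℝ × ℝ) → ℝ, Tendsto θ F (𝓝 t₀) → (∀ᶠ q in F, θ q ∈ Icc α β) →
      Tendsto (fun q : ℝ × (ℝ × ℝ) => (φ (q.2.1 + q.1, θ q) - φ (q.2.1, θ q)) / q.1) F
        (𝓝 φx) := by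
    intro θ hθ hθm
    have := strip_tendsto_quotient hαβ hφ1 hp₀ (1, 0) (hx.prodMk_nhds hθ) hfst0
      (hh0.mono fun q h => h.ne') (hθm.mono fun q h => mem_strip.2 h)
      (hθm.mono fun q h => mem_strip.2 (by simpa using h))
    simpa using this
  have hbwd : ∀ θ : ℝ × (ℝ × ℝ) → ℝ, Tendsto θ F (𝓝 t₀) → (∀ᶠ q in F, θ q ∈ Icc α β) →
      Tendsto (fun q : ℝ × (ℝ × ℝ) => (φ (q.2.1, θ q) - φ (q.2.1 - q.1, θ q)) / q.1) F
        (𝓝 φx) := by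
    intro θ hθ hθm
    have := strip_tendsto_quotient hαβ hφ1 hp₀ (1, 0) (hx.prodMk_nhds hθ)
      (a := fun q : ℝ × (ℝ × ℝ) => -q.1) (by simpa using hfst0.neg)
      (hh0.mono fun q h => by simpa using h.ne') (hθm.mono fun q h => mem_strip.2 h)
      (hθm.mono fun q h => mem_strip.2 (by simpa using h))
    refine this.congr fun q => ?_
    rw [div_neg, ← neg_div, neg_sub]
    simp [sub_eq_add_neg]
  have htm : ∀ᶠ q in F, q.2.2 ∈ Icc α β := hmem.mono fun q h => mem_strip.1 h
  have T3 : Tendsto (fun q : ℝ × (ℝ × ℝ) =>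
      upwindDiff q.1 (ω q.1) (fun y => φ (y, q.2.2 - τ q.1)) q.2.1) F (𝓝 φx) := by
    unfold upwindDiff
    exact (hfwd _ htτ htmem).if' (hbwd _ htτ htmem)
  have T4 := hfwd _ ht htm
  have T5 := hbwd _ ht htm
  have hφx : 0 ≤ φx := by
    have h1 : Tendsto (fun q : ℝ × (ℝ × ℝ) => -τ q.1) F (𝓝 0) := by simpa using hτF.neg
    refine le_of_tendsto_of_tendsto h1 T4 ?_
    filter_upwards [hprop, hh0, htm, hfst.eventually hstab] with q h2 h3 h4 h5
    obtain ⟨P, A, -, -, h6⟩ := h5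
    have h7 := h2.2 (q.2.1 + q.1, q.2.2) (mem_strip.2 h4)
    have h8 := (h6 ⌊q.2.2 / τ q.1⌋₊).mono (show q.2.1 ≤ q.2.1 + q.1 by linarith)
    simp only [extScheme] at h7
    rw [le_div_iff₀ h3]
    linarith
  -- the cut-off slope is squeezed between two quantities tending to `φx`
  have T6 : Tendsto (fun q : ℝ × (ℝ × ℝ) =>
      max 0 (upwindDiff q.1 (ω q.1) (fun y => φ (y, q.2.2 - τ q.1)) q.2.1)) F (𝓝 φx) := by
    have := tendsto_const_nhds.max T3 (a₁ := (0 : ℝ))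
    rwa [max_eq_right hφx] at this
  have T7 : Tendsto (fun q : ℝ × (ℝ × ℝ) =>
      max 0 (min (upwindDiff q.1 (ω q.1) (fun y => φ (y, q.2.2 - τ q.1)) q.2.1)
        ((φ (q.2.1, q.2.2) - φ (q.2.1 - q.1, q.2.2)) / q.1 - τ q.1))) F (𝓝 φx) := by
    have h1 := T5.sub hτF
    have := tendsto_const_nhds.max (T3.min h1) (a₁ := (0 : ℝ))
    rwa [sub_zero, min_self, max_eq_right hφx] at this
  have hm0 : 0 ≤ m - 1 := by linarith
  have hlim := T1.add (((T7.rpow_const (Or.inr hm0)).mul T2).min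
    ((T6.rpow_const (Or.inr hm0)).mul T2))
  rw [min_self] at hlim
  rw [abs_of_nonneg hφx]
  refine le_of_tendsto_of_tendsto hlim hfst0 ?_
  filter_upwards [hprop, hh0, htm, hτF0, hfst.eventually hstab, hfst.eventually hadm]
    with q h2 h3 h4 h5 h6 hw
  obtain ⟨P, A, hP, hcfl, h6⟩ := h6
  have h7 := discrete_inequality hw hm h3 h5 hP hcfl h6 hα h2.1 h4.2 hB h2.2 (x := q.2.1)
  have h8 : (φ (q.2.1, q.2.2) - φ (q.2.1 - q.1, q.2.2)) / q.1 - τ q.1 ≤ P := by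
    have h9 := h2.2 (q.2.1 - q.1, q.2.2) (mem_strip.2 h4)
    have h10 := (h6 ⌊q.2.2 / τ q.1⌋₊).slope (q.2.1 - q.1)
    simp only [extScheme, sub_add_cancel] at h9 h10
    rw [sub_le_iff_le_add, div_le_iff₀ h3]
    linarith
  set D := upwindDiff q.1 (ω q.1) (fun y => φ (y, q.2.2 - τ q.1)) q.2.1
  set b := discFracLap q.1 (ω q.1) (fun y => φ (y, q.2.2 - τ q.1)) q.2.1
  refine le_trans (add_le_add_right ?_ _) h7
  have hr0 : (0 : ℝ) ≤ max 0 (min D P) := le_max_left _ _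
  rcases le_total 0 b with hb | hb
  · refine (min_le_left _ _).trans (mul_le_mul_of_nonneg_right ?_ hb)
    exact Real.rpow_le_rpow (le_max_left _ _)
      (max_le_max le_rfl (min_le_min le_rfl h8)) hm0
  · refine (min_le_right _ _).trans (mul_le_mul_of_nonpos_right ?_ hb)
    exact Real.rpow_le_rpow hr0 (max_le_max le_rfl (min_le_left _ _)) hm0

end Core

/-! ### Subsolutions, and supersolutions by reflection -/

section Subsolution

variable {s m M T α β : ℝ} {ω : ℝ → ℤ → ℝ} {v₀ : ℝ → ℝ} {τ : ℝ → ℝ}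

/-- The viscosity inequality for a test function touching the upper relaxed limit from above on a
strip. The hypothesis `htime` says that the approximate maximum points are not on the initial time
layer, where `V_h` has not yet been updated. -/
theorem eqn_le_zero_of_isMax (hs : s ∈ Ioo (0 : ℝ) 1) (hm : 2 ≤ m)
    (hcons : ConsistentWeights s ω) (hadm : ∀ᶠ h in 𝓝[>] (0 : ℝ), AdmissibleWeights (ω h))
    (hτpos : ∀ᶠ h in 𝓝[>] (0 : ℝ), 0 < τ h) (hτ : Tendsto τ (𝓝[>] 0) (𝓝 0))
    (hstab : ∀ᶠ h in 𝓝[>] (0 : ℝ), StableScheme m h (τ h) (ω h) M v₀)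
    (hV : ∀ᶠ h in 𝓝[>] (0 : ℝ), ∀ q, |extScheme m h (τ h) (ω h) v₀ q| ≤ M)
    (hαβ : α < β) (hα : 0 ≤ α) (hK : strip α β ⊆ closedCyl T) {φ : ℝ × ℝ → ℝ} {B : ℝ}
    (hφ : ContDiffOn ℝ 2 φ (strip α β)) (hB : ∀ p ∈ strip α β, |φ p| ≤ B) {x₀ t₀ : ℝ}
    (ht₀ : t₀ ∈ Icc α β) (hKn : strip α β ∈ 𝓝[closedCyl T] (x₀, t₀)) {v : ℝ × ℝ → ℝ}
    (hv : v = upperRelaxedLimit T fun h => extScheme m h (τ h) (ω h) v₀)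
    (hmax : ∀ p ∈ strip α β, v p - φ p ≤ v (x₀, t₀) - φ (x₀, t₀)) {η : ℝ} (hη : 0 < η)
    (htime : ∀ᶠ q : ℝ × (ℝ × ℝ) in 𝓝[>] (0 : ℝ) ×ˢ 𝓝[strip α β] (x₀, t₀),
      v (x₀, t₀) - η < extScheme m q.1 (τ q.1) (ω q.1) v₀ q.2 → α ≤ q.2.2 - τ q.1) :
    fderivWithin ℝ φ (strip α β) (x₀, t₀) (0, 1) +
      |fderivWithin ℝ φ (strip α β) (x₀, t₀) (1, 0)| ^ (m - 1) *
        fracLap s (fun y => φ (y, t₀)) x₀ ≤ 0 := by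
  have hp₀ : (x₀, t₀) ∈ strip α β := mem_strip.2 ht₀
  have hvM : |v (x₀, t₀)| ≤ M := by
    rw [hv]
    exact abs_upperRelaxedLimit_le hV (hK hp₀)
  have hM0 : 0 ≤ M := (abs_nonneg _).trans hvM
  have hB0 : 0 ≤ B := (abs_nonneg _).trans (hB _ hp₀)
  -- Half of `C` exceeds the oscillation of `V_h - φ` by `1`.
  set C := 4 * M + 4 * B + 2 with hC
  have hC0 : 0 < C := by positivity
  set φt := fderivWithin ℝ φ (strip α β) (x₀, t₀) (0, 1) with hφt
  set φx := fderivWithin ℝ φ (strip α β) (x₀, t₀) (1, 0) with hφx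
  -- The penalization makes the maximum strict and confines the approximate maximum points to
  -- `|x - x₀| < R`; its contribution to the fractional Laplacian vanishes as `R → ∞`.
  have key : ∀ R : ℝ, 1 ≤ R → φt + |φx| ^ (m - 1) * (fracLap s (fun y => φ (y, t₀)) x₀ +
      C * fracLap s (fun y => bump R (y - x₀)) x₀) ≤ 0 := by
    intro R hR
    have hR0 : 0 < R := by linarith
    set ρ : ℝ × ℝ → ℝ := fun p => C * bump R (p.1 - x₀) + (p.2 - t₀) ^ 2 with hρ
    have hρC : ContDiff ℝ 2 ρ :=
      (contDiff_const.mul ((bump_contDiff hR0).comp (contDiff_fst.sub contDiff_const))).add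
        ((contDiff_snd.sub contDiff_const).pow 2)
    have hρ0 : ρ (x₀, t₀) = 0 := by simp [hρ, bump_zero]
    have hρnn : ∀ p, 0 ≤ ρ p := fun p =>
      add_nonneg (mul_nonneg hC0.le (bump_nonneg _ _)) (sq_nonneg _)
    have hρpos : ∀ p, p ≠ (x₀, t₀) → 0 < ρ p := by
      rintro ⟨x, t⟩ hne
      by_cases hx : x = x₀
      · have ht : t - t₀ ≠ 0 := by
          rintro ht
          exact hne (by rw [hx, sub_eq_zero.1 ht])
        exact add_pos_of_nonneg_of_pos (mul_nonneg hC0.le (bump_nonneg _ _)) (by positivity)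
      · exact add_pos_of_pos_of_nonneg (mul_pos hC0 (bump_pos hR0 (sub_ne_zero.2 hx)))
          (sq_nonneg _)
    have hρd : fderiv ℝ ρ (x₀, t₀) = 0 :=
      IsLocalMin.fderiv_eq_zero (Eventually.of_forall fun p => by rw [hρ0]; exact hρnn p)
    have hρdiff : DifferentiableAt ℝ ρ (x₀, t₀) := (hρC.differentiable two_ne_zero) _
    have huniq := strip_uniqueDiffOn hαβ (x₀, t₀) hp₀
    have hder : fderivWithin ℝ (fun p => φ p + ρ p) (strip α β) (x₀, t₀) =
        fderivWithin ℝ φ (strip α β) (x₀, t₀) := by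
      rw [fderivWithin_fun_add huniq (hφ.differentiableOn two_ne_zero _ hp₀)
        hρdiff.differentiableWithinAt, hρdiff.fderivWithin huniq, hρd, add_zero]
    have hψC : ContDiffOn ℝ 2 (fun p => φ p + ρ p) (strip α β) := hφ.add hρC.contDiffOn
    have hψB : ∀ p ∈ strip α β, |φ p + ρ p| ≤ B + (C + (β - α) ^ 2) := by
      intro p hp
      refine (abs_add_le _ _).trans (add_le_add (hB p hp) ?_)
      rw [abs_of_nonneg (hρnn p)]
      refine add_le_add (mul_le_of_le_one_right hC0.le (bump_le_one _ _)) ?_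
      obtain ⟨h1, h2⟩ := mem_strip.1 hp
      obtain ⟨h3, h4⟩ := ht₀
      exact sq_le_sq' (by linarith) (by linarith)
    -- The error `τ h` of the approximate maxima is small even after division by the time step.
    have hfreq := frequently_approx_max (R := R) hV hK hp₀ hKn hψC.continuousOn hψB
      (fun p hp hne => by
        have h1 := hmax p hp
        have h2 := hρpos p hne
        rw [← hv]
        simp only [hρ0]
        linarith)
      (fun p hp hfar => by
        rw [← hv]
        simp only [hρ0]
        have h1 := half_le_bump hR0 hfar
        have h2 := abs_le.1 hvM
        have h3 := abs_le.1 (hB p hp)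
        have h4 := abs_le.1 (hB _ hp₀)
        have h5 : C * (1 / 2) ≤ ρ p :=
          (mul_le_mul_of_nonneg_left h1 hC0.le).trans (le_add_of_nonneg_right (sq_nonneg _))
        linarith)
      (ε := fun h => τ h * h) (by
        filter_upwards [hτpos, self_mem_nhdsWithin] with h h1 h2
        exact mul_pos h1 h2) hη
    rw [← hv] at hfreq
    have hfreq' := hfreq.and_eventually htime
    have hfin := eqn_le_zero_of_frequently_approx_max hs hm hcons hadm hτpos hτ hstab hαβ hα
      hψC hψB ht₀ (hfreq'.mono fun q hq => ⟨hq.2 hq.1.1, hq.1.2⟩)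
    rw [hder] at hfin
    have hlap : fracLap s (fun y => φ (y, t₀) + ρ (y, t₀)) x₀ =
        fracLap s (fun y => φ (y, t₀)) x₀ + C * fracLap s (fun y => bump R (y - x₀)) x₀ := by
      have hb : ContDiff ℝ 2 fun y => bump R (y - x₀) :=
        (bump_contDiff hR0).comp (contDiff_id.sub contDiff_const)
      rw [← hcons.fracLap_const_mul hadm hb (fun y => abs_bump_le R _),
        ← hcons.fracLap_add hadm (contDiff_slice hφ ht₀) (fun y => hB _ (mem_strip.2 ht₀))
          (contDiff_const.mul hb) (B' := C) (fun y => by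
            rw [abs_mul, abs_of_pos hC0]
            exact mul_le_of_le_one_right hC0.le (abs_bump_le R _))]
      simp [hρ]
    rwa [hlap] at hfin
  have hlim : Tendsto (fun R => φt + |φx| ^ (m - 1) * (fracLap s (fun y => φ (y, t₀)) x₀ +
      C * fracLap s (fun y => bump R (y - x₀)) x₀)) atTop
      (𝓝 (φt + |φx| ^ (m - 1) * (fracLap s (fun y => φ (y, t₀)) x₀ + C * 0))) :=
    ((((fracLap_bump_tendsto hs x₀).const_mul C).const_add _).const_mul _).const_add _
  rw [mul_zero, add_zero] at hlim
  exact le_of_tendsto hlim ((eventually_ge_atTop 1).mono key)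

theorem eqnOp_eq {φ : ℝ × ℝ → ℝ} (hT : 0 < T) (hφ : DifferentiableOn ℝ φ (strip α β)) {x₀ t₀ : ℝ}
    (ht₀ : t₀ ∈ Icc α β) (ht₀' : t₀ ∈ Icc 0 T) (hn : Icc α β ∈ 𝓝[Icc 0 T] t₀) :
    eqnOp s m T φ x₀ t₀ = fderivWithin ℝ φ (strip α β) (x₀, t₀) (0, 1) +
      |fderivWithin ℝ φ (strip α β) (x₀, t₀) (1, 0)| ^ (m - 1) *
        fracLap s (fun y => φ (y, t₀)) x₀ := by
  unfold eqnOp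
  rw [((hasDerivWithinAt_slice hφ ht₀ x₀).mono_of_mem_nhdsWithin hn).derivWithin
    (uniqueDiffOn_Icc hT t₀ ht₀'), (hasDerivAt_slice hφ ht₀ x₀).deriv]

theorem strip_mem_nhdsWithin {x₀ t₀ : ℝ} (hn : Icc α β ∈ 𝓝[Icc 0 T] t₀) :
    strip α β ∈ 𝓝[closedCyl T] (x₀, t₀) := by
  rw [closedCyl, nhdsWithin_prod_eq, nhdsWithin_univ]
  exact prod_mem_prod univ_mem hn

/-- The upper relaxed limit of a stable and consistent scheme is a subsolution. -/
theorem isViscSubsol_upperRelaxedLimit (hs : s ∈ Ioo (0 : ℝ) 1) (hm : 2 ≤ m) (hT : 0 < T)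
    (hv₀ : ∀ x, |v₀ x| ≤ M)
    (hcons : ConsistentWeights s ω) (hadm : ∀ᶠ h in 𝓝[>] (0 : ℝ), AdmissibleWeights (ω h))
    (hτpos : ∀ᶠ h in 𝓝[>] (0 : ℝ), 0 < τ h) (hτ : Tendsto τ (𝓝[>] 0) (𝓝 0))
    (hstab : ∀ᶠ h in 𝓝[>] (0 : ℝ), StableScheme m h (τ h) (ω h) M v₀) :
    IsViscSubsol s m T v₀ (upperRelaxedLimit T fun h => extScheme m h (τ h) (ω h) v₀) := by
  have hV : ∀ᶠ h in 𝓝[>] (0 : ℝ), ∀ q, |extScheme m h (τ h) (ω h) v₀ q| ≤ M := by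
    filter_upwards [hstab] with h ⟨P, A, _, _, H⟩ q
    exact (H _).bounded _
  refine ⟨⟨M, fun p hp => abs_upperRelaxedLimit_le hV hp⟩, upperRelaxedLimit_usc hV, ?_, ?_⟩
  · rintro φ ⟨hφ, B, hB⟩ x₀ t₀ ⟨-, ht0, htT⟩ hmax
    simp only at ht0 htT
    obtain ⟨α, hα0, hαt⟩ := exists_between ht0
    obtain ⟨β, hβt, hβT⟩ := exists_between htT
    have hsub : strip α β ⊆ openCyl T := fun p hp =>
      ⟨mem_univ _, hα0.trans_le (mem_strip.1 hp).1, (mem_strip.1 hp).2.trans_lt hβT⟩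
    have hsub' : strip α β ⊆ closedCyl T := fun p hp =>
      ⟨mem_univ _, (hsub hp).2.1.le, (hsub hp).2.2.le⟩
    have ht₀ : t₀ ∈ Icc α β := ⟨hαt.le, hβt.le⟩
    have hn : Icc α β ∈ 𝓝[Icc 0 T] t₀ := mem_nhdsWithin_of_mem_nhds (Icc_mem_nhds hαt hβt)
    rw [eqnOp_eq hT ((hφ.mono hsub).differentiableOn two_ne_zero) ht₀ ⟨ht0.le, htT.le⟩ hn]
    refine eqn_le_zero_of_isMax hs hm hcons hadm hτpos hτ hstab hV (hαt.trans hβt) hα0.le hsub'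
      (hφ.mono hsub) (fun p hp => hB p (hsub hp)) ht₀ (strip_mem_nhdsWithin hn) rfl
      (fun p hp => hmax (hsub hp)) one_pos ?_
    have h1 : Tendsto (fun q : ℝ × (ℝ × ℝ) => q.2.2 - τ q.1)
        (𝓝[>] (0 : ℝ) ×ˢ 𝓝[strip α β] (x₀, t₀)) (𝓝 (t₀ - 0)) :=
      ((continuous_snd.tendsto (x₀, t₀)).comp
        (tendsto_snd.mono_right nhdsWithin_le_nhds)).sub (hτ.comp tendsto_fst)
    rw [sub_zero] at h1
    exact (h1.eventually_const_lt hαt).mono fun q hq _ => hq.le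
  · rintro φ ⟨hφ, B, hB⟩ x₀ hmax
    by_contra! hcon
    obtain ⟨hc1, hc2⟩ := lt_min_iff.1 hcon
    set v := upperRelaxedLimit T fun h => extScheme m h (τ h) (ω h) v₀ with hv
    have ht₀ : (0 : ℝ) ∈ Icc 0 T := ⟨le_rfl, hT.le⟩
    have hn : Icc 0 T ∈ 𝓝[Icc 0 T] (0 : ℝ) := self_mem_nhdsWithin
    rw [eqnOp_eq (α := 0) (β := T) hT (hφ.differentiableOn two_ne_zero) ht₀ ht₀ hn] at hc2
    set η := (v (x₀, 0) - upperEnv v₀ x₀) / 2 with hη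
    have hη0 : 0 < η := by
      rw [hη]
      linarith
    refine absurd (eqn_le_zero_of_isMax hs hm hcons hadm hτpos hτ hstab hV hT le_rfl subset_rfl
      hφ hB ht₀ (strip_mem_nhdsWithin hn) hv (fun p hp => hmax hp) hη0 ?_) (not_le.2 hc2)
    -- On the initial layer `V_h = v₀`, which is below `v̄(x₀, 0)` near `x₀`.
    have h1 : ∀ᶠ x in 𝓝 x₀, v₀ x < v (x₀, 0) - η :=
      eventually_lt_of_limsup_lt (show upperEnv v₀ x₀ < v (x₀, 0) - η by linarith)
        (isBoundedUnder_of_eventually_le (Eventually.of_forall fun x => (abs_le.1 (hv₀ x)).2))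
    have h2 : ∀ᶠ q in 𝓝[strip 0 T] (x₀, 0), v₀ q.1 < v (x₀, 0) - η ∧ q ∈ strip 0 T :=
      ((continuous_fst.tendsto (x₀, (0 : ℝ))).mono_left nhdsWithin_le_nhds |>.eventually h1).and
        eventually_mem_nhdsWithin
    filter_upwards [h2.prod_inr (𝓝[>] (0 : ℝ))] with q ⟨hq1, hq2⟩ hq3
    by_contra! hlt
    rw [extScheme_initial m q.1 (τ q.1) (ω q.1) v₀ q.2.1 q.2.2
      ⟨(mem_strip.1 hq2).1, by linarith⟩] at hq3
    linarith

end Subsolution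

section Hypotheses

variable {s m T Cs M : ℝ} {v₀ : ℝ → ℝ} {ω : ℝ → ℤ → ℝ} {J : ℝ → ℕ}

theorem eventually_le_exp : ∀ᶠ h in 𝓝[>] (0 : ℝ), h ≤ Real.exp (-1) :=
  (eventually_le_nhds (Real.exp_pos (-1))).filter_mono nhdsWithin_le_nhds

theorem tendsto_zero_of_mul_le {τ : ℝ → ℝ} {C : ℝ} (hC : 0 < C)
    (hτpos : ∀ᶠ h in 𝓝[>] (0 : ℝ), 0 < τ h) (hle : ∀ᶠ h in 𝓝[>] (0 : ℝ), C * τ h ≤ h) :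
    Tendsto τ (𝓝[>] 0) (𝓝 0) := by
  have h1 : Tendsto (fun h : ℝ => h / C) (𝓝[>] 0) (𝓝 0) := by
    have := ((tendsto_id (α := ℝ) (x := 𝓝 0)).div_const C).mono_left
      (nhdsWithin_le_nhds (s := Ioi 0))
    simpa using this
  refine tendsto_of_tendsto_of_tendsto_of_le_of_le' tendsto_const_nhds h1
    (hτpos.mono fun h hh => hh.le) (hle.mono fun h hh => ?_)
  rw [le_div_iff₀ hC]
  linarith

/-- Under either CFL condition the upper relaxed limit is a subsolution. For constant data the CFL
conditions need not force the time step to zero, but then neither does the scheme depend on it. -/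
theorem isViscSubsol_of_CFL (hs : s ∈ Ioo (0 : ℝ) 1) (hm : 2 ≤ m) (hT : 0 < T)
    (hmono : Monotone v₀) (hbdd : ∀ x, |v₀ x| ≤ M)
    (hadm : ∀ᶠ h in 𝓝[>] (0 : ℝ), AdmissibleWeights (ω h))
    (hCs : 0 < Cs) (hweights : ∀ᶠ h in 𝓝[>] (0 : ℝ), WeightBounds s Cs h (ω h))
    (hcons : ConsistentWeights s ω) (hJ : ∀ h > 0, 0 < J h)
    (hCFL : (∀ᶠ h in 𝓝[>] (0 : ℝ), CFL1 s m Cs M h (T / J h)) ∨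
      ∃ L : ℝ, (∀ x y, |v₀ x - v₀ y| ≤ L * |x - y|) ∧
        ∀ᶠ h in 𝓝[>] (0 : ℝ), CFL2 s m Cs M L h (T / J h)) :
    IsViscSubsol s m T v₀ (upperRelaxedLimit T fun h => extScheme m h (T / J h) (ω h) v₀) := by
  have hM : 0 ≤ M := (abs_nonneg _).trans (hbdd 0)
  have hpos : ∀ᶠ h in 𝓝[>] (0 : ℝ), 0 < h := eventually_mem_nhdsWithin
  have hτpos : ∀ᶠ h in 𝓝[>] (0 : ℝ), 0 < T / J h := by
    filter_upwards [hpos] with h hh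
    have : (0 : ℝ) < J h := Nat.cast_pos.2 (hJ h hh)
    positivity
  by_cases hconst : ∀ x, v₀ x = v₀ 0
  · have hv₀ : v₀ = fun _ => v₀ 0 := funext hconst
    have hτ : Tendsto (fun h : ℝ => h) (𝓝[>] 0) (𝓝 0) := nhdsWithin_le_nhds
    have hmain := isViscSubsol_upperRelaxedLimit hs hm hT hbdd hcons hadm hpos hτ
      (M := M) (Eventually.of_forall fun h => by
        rw [hv₀]
        exact stableScheme_const hm _ (hbdd 0))
    have : (fun h => extScheme m h (T / J h) (ω h) v₀) = fun h => extScheme m h h (ω h) v₀ := by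
      funext h p
      rw [hv₀]
      simp only [extScheme, schemeIter_const]
    rwa [this]
  · rcases hCFL with hcfl | ⟨L, hlip, hcfl⟩
    · have hM0 : 0 < M := by
        refine hM.lt_of_ne fun h0 => hconst fun x => ?_
        have h1 := hbdd x
        have h2 := hbdd 0
        rw [← h0, abs_nonpos_iff] at h1 h2
        rw [h1, h2]
      refine isViscSubsol_upperRelaxedLimit hs hm hT hbdd hcons hadm hτpos
        (tendsto_zero_of_mul_le (C := Cs * m * (2 * M) ^ (m - 1)) (by positivity) hτpos ?_) ?_
      · filter_upwards [hcfl, hpos, eventually_le_exp] with h h1 h2 h3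
        refine h1.trans ?_
        simpa using Real.rpow_le_rpow_of_exponent_ge h2 (le_one_of_le_exp h3)
          (show 1 ≤ 2 * s + m - 1 by linarith [hs.1])
      · filter_upwards [hadm, hweights, hcfl, hpos, hτpos] with h h1 h2 h3 h4 h5
        exact stableScheme_of_CFL1 h1 h2 hm h4 h5 hmono hbdd h3
    · have hL0 : 0 < L := by
        by_contra! hL
        refine hconst fun x => ?_
        have h1 := (hlip x 0).trans (mul_nonpos_of_nonpos_of_nonneg hL (abs_nonneg _))
        exact sub_eq_zero.1 (abs_nonpos_iff.1 h1)
      have hΛ : 0 < max L (2 * M) := hL0.trans_le (le_max_left _ _)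
      refine isViscSubsol_upperRelaxedLimit hs hm hT hbdd hcons hadm hτpos
        (tendsto_zero_of_mul_le (C := Cs * m * L ^ (m - 2) * max L (2 * M)) (by positivity)
          hτpos ?_) ?_
      · filter_upwards [hcfl, hpos, eventually_le_exp] with h h1 h2 h3
        exact le_trans h1 (stepScale_le h2 h3)
      · filter_upwards [hadm, hweights, hcfl, hpos, hτpos, eventually_le_exp]
          with h h1 h2 h3 h4 h5 h6
        exact stableScheme_of_CFL2 h1 h2 hm hL0.le hCs h4 h6 h5 hmono hbdd hlip h3

end Hypotheses

section Reflection

variable {s m T : ℝ} {ω : ℝ → ℤ → ℝ} {v₀ : ℝ → ℝ}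

theorem limsup_neg_eq {ι : Type*} (F : Filter ι) (u : ι → ℝ) :
    limsup (fun i => -u i) F = -liminf u F := by
  rw [limsup_eq, liminf_eq, Real.sInf_def]
  congr 2
  ext a
  simp

theorem upperEnv_reflect (f : ℝ → ℝ) (x : ℝ) :
    upperEnv (fun y => -f (-y)) (-x) = -lowerEnv f x := by
  have h : map (fun y : ℝ => -y) (𝓝 (-x)) = 𝓝 x := by
    simpa using (Homeomorph.neg ℝ).map_nhds_eq (-x)
  rw [upperEnv, lowerEnv, limsup_neg_eq, ← h]
  rfl

/-- The reflection `(x, t) ↦ (-x, t)`. -/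
def spaceReflect (p : ℝ × ℝ) : ℝ × ℝ := (-p.1, p.2)

theorem spaceReflect_spaceReflect (p : ℝ × ℝ) : spaceReflect (spaceReflect p) = p := by
  simp [spaceReflect]

theorem spaceReflect_contDiff {n : WithTop ℕ∞} : ContDiff ℝ n spaceReflect :=
  contDiff_fst.neg.prodMk contDiff_snd

theorem spaceReflect_mem_closedCyl {p : ℝ × ℝ} (hp : p ∈ closedCyl T) :
    spaceReflect p ∈ closedCyl T := ⟨mem_univ _, hp.2⟩

theorem spaceReflect_mem_openCyl {p : ℝ × ℝ} (hp : p ∈ openCyl T) :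
    spaceReflect p ∈ openCyl T := ⟨mem_univ _, hp.2⟩

theorem tendsto_spaceReflect (p : ℝ × ℝ) :
    Tendsto spaceReflect (𝓝[closedCyl T] p) (𝓝[closedCyl T] (spaceReflect p)) :=
  (spaceReflect_contDiff (n := 0)).continuous.continuousWithinAt.tendsto_nhdsWithin
    fun _ hq => spaceReflect_mem_closedCyl hq

theorem map_spaceReflect (p : ℝ × ℝ) :
    map spaceReflect (𝓝[closedCyl T] (spaceReflect p)) = 𝓝[closedCyl T] p := by
  refine le_antisymm ?_ ?_
  · have := tendsto_spaceReflect (T := T) (spaceReflect p)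
    rwa [spaceReflect_spaceReflect] at this
  · have h := map_mono (m := spaceReflect) (tendsto_spaceReflect (T := T) p)
    rw [map_map, show spaceReflect ∘ spaceReflect = id from funext spaceReflect_spaceReflect,
      map_id] at h
    exact h

theorem schemeIter_reflect {h τ : ℝ} {w : ℤ → ℝ} (hsymm : ∀ k, w (-k) = w k) (j : ℕ) :
    schemeIter m h τ w (fun y => -v₀ (-y)) j = fun x => -schemeIter m h τ w v₀ j (-x) := by
  induction j with
  | zero => rfl
  | succ j ih =>
    funext x
    simp only [schemeIter, ih, discOp_reflect hsymm]
    ring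

theorem lowerRelaxedLimit_eq_neg {τ : ℝ → ℝ} (hsymm : ∀ h > 0, ∀ k, ω h (-k) = ω h k)
    (p : ℝ × ℝ) :
    lowerRelaxedLimit T (fun h => extScheme m h (τ h) (ω h) v₀) p =
      -upperRelaxedLimit T (fun h => extScheme m h (τ h) (ω h) fun y => -v₀ (-y))
        (spaceReflect p) := by
  have h1 : upperRelaxedLimit T (fun h => extScheme m h (τ h) (ω h) fun y => -v₀ (-y))
      (spaceReflect p) = limsup (fun q : ℝ × (ℝ × ℝ) =>
        -extScheme m q.1 (τ q.1) (ω q.1) v₀ (spaceReflect q.2))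
        (𝓝[>] (0 : ℝ) ×ˢ 𝓝[closedCyl T] (spaceReflect p)) := by
    refine limsup_congr ?_
    have : ∀ᶠ h in 𝓝[>] (0 : ℝ), 0 < h := eventually_mem_nhdsWithin
    filter_upwards [this.prod_inl _] with q hq
    simp only [extScheme, schemeIter_reflect (hsymm q.1 hq), spaceReflect]
  have h2 : map (Prod.map id spaceReflect) (𝓝[>] (0 : ℝ) ×ˢ 𝓝[closedCyl T] (spaceReflect p)) =
      𝓝[>] (0 : ℝ) ×ˢ 𝓝[closedCyl T] p := by
    rw [← prod_map_map_eq', map_id, map_spaceReflect]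
  rw [h1, limsup_neg_eq, neg_neg, lowerRelaxedLimit, ← h2]
  rfl

/-- The reflection `φ ↦ -φ(-·, ·)` changes the sign of the equation. -/
theorem eqnOp_reflect (hcons : ConsistentWeights s ω)
    (hadm : ∀ᶠ h in 𝓝[>] (0 : ℝ), AdmissibleWeights (ω h)) {φ : ℝ × ℝ → ℝ} {Q : Set (ℝ × ℝ)}
    (hφ : IsTestFun Q φ) {x t : ℝ} (hQ : strip t t ⊆ Q) :
    eqnOp s m T (fun p => -φ (spaceReflect p)) (-x) t = -eqnOp s m T φ x t := by
  obtain ⟨hC, B, hB⟩ := hφ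
  have ht : t ∈ Icc t t := ⟨le_rfl, le_rfl⟩
  have h1 : fracLap s (fun y => -φ (-y, t)) (-x) = -fracLap s (fun y => φ (y, t)) x := by
    have := hcons.fracLap_reflect hadm (contDiff_slice (hC.mono hQ) ht)
      (fun y => hB _ (hQ (mem_strip.2 ht))) (-x)
    rwa [neg_neg] at this
  have h2 : deriv (fun y => -φ (-y, t)) (-x) = deriv (fun y => φ (y, t)) x := by
    rw [deriv.fun_neg, deriv_comp_neg (fun y => φ (y, t))]
    simp
  have h3 : derivWithin (fun r => -φ (x, r)) (Icc 0 T) t =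
      -derivWithin (fun r => φ (x, r)) (Icc 0 T) t := derivWithin.fun_neg
  simp only [eqnOp, spaceReflect, neg_neg, h1, h2, h3]
  ring

theorem isTestFun_reflect {φ : ℝ × ℝ → ℝ} {Q : Set (ℝ × ℝ)} (hφ : IsTestFun Q φ)
    (hQ : ∀ p ∈ Q, spaceReflect p ∈ Q) : IsTestFun Q fun p => -φ (spaceReflect p) := by
  obtain ⟨hC, B, hB⟩ := hφ
  exact ⟨(hC.comp spaceReflect_contDiff.contDiffOn hQ).neg, B, fun p hp => by
    simpa using hB _ (hQ p hp)⟩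

/-- Reflecting a subsolution for the reflected datum gives a supersolution. -/
theorem IsViscSubsol.reflect (hT : 0 < T) (hcons : ConsistentWeights s ω)
    (hadm : ∀ᶠ h in 𝓝[>] (0 : ℝ), AdmissibleWeights (ω h)) {u : ℝ × ℝ → ℝ}
    (hu : IsViscSubsol s m T (fun y => -v₀ (-y)) u) :
    IsViscSupersol s m T v₀ fun p => -u (spaceReflect p) := by
  refine ⟨?_, ?_, ?_, ?_⟩
  · obtain ⟨B, hB⟩ := hu.bounded
    exact ⟨B, fun p hp => by simpa using hB _ (spaceReflect_mem_closedCyl hp)⟩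
  · intro p hp y hy
    have h1 := hu.usc _ (spaceReflect_mem_closedCyl hp) (-y) (by linarith)
    filter_upwards [(tendsto_spaceReflect p).eventually h1] with q hq
    linarith
  · intro φ hφ x₀ t₀ h0 hmin
    have h1 := hu.interior _ (isTestFun_reflect hφ fun p hp => spaceReflect_mem_openCyl hp)
      (-x₀) t₀ (spaceReflect_mem_openCyl h0) (fun p hp => by
        have := hmin (spaceReflect_mem_openCyl hp)
        simp only [mem_ofPred_eq, spaceReflect, neg_neg] at this ⊢
        linarith)
    rw [eqnOp_reflect hcons hadm hφ fun p hp => ⟨mem_univ _, by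
      rw [le_antisymm (mem_strip.1 hp).2 (mem_strip.1 hp).1]
      exact h0.2⟩] at h1
    linarith
  · intro φ hφ x₀ hmin
    have h1 := hu.initial _ (isTestFun_reflect hφ fun p hp => spaceReflect_mem_closedCyl hp)
      (-x₀) (fun p hp => by
        have := hmin (spaceReflect_mem_closedCyl hp)
        simp only [mem_ofPred_eq, spaceReflect, neg_neg] at this ⊢
        linarith)
    rw [eqnOp_reflect hcons hadm hφ fun p hp => ⟨mem_univ _, by
      rw [le_antisymm (mem_strip.1 hp).2 (mem_strip.1 hp).1]
      exact ⟨le_rfl, hT.le⟩⟩, upperEnv_reflect] at h1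
    simp only [spaceReflect]
    rcases min_le_iff.1 h1 with h2 | h2
    · exact le_max_of_le_left (by linarith)
    · exact le_max_of_le_right (by linarith)

end Reflection

end

theorem theorem5p6 (s m T Cs M : ℝ) (hs : s ∈ Ioo (0 : ℝ) 1) (hm : 2 ≤ m) (hT : 0 < T)
    (v₀ : ℝ → ℝ) (hmono : Monotone v₀) (hbdd : ∀ x, |v₀ x| ≤ M)
    -- the weights `ω h k`, symmetric and nonnegative
    (ω : ℝ → ℤ → ℝ) (hsymm : ∀ h > 0, ∀ k, ω h (-k) = ω h k) (hnonneg : ∀ h > 0, ∀ k, 0 ≤ ω h k)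
    -- bounds on the weights for small `h`, and consistency
    (hCs : 0 < Cs) (hweights : ∀ᶠ h in 𝓝[>] (0 : ℝ), WeightBounds s Cs h (ω h))
    (hcons : ConsistentWeights s ω)
    -- the time step is `τ = T / J`, where `J = J h` is a positive integer
    (J : ℝ → ℕ) (hJ : ∀ h > 0, 0 < J h)
    (hCFL : (∀ᶠ h in 𝓝[>] (0 : ℝ), CFL1 s m Cs M h (T / J h)) ∨
      ∃ L : ℝ, (∀ x y, |v₀ x - v₀ y| ≤ L * |x - y|) ∧
        ∀ᶠ h in 𝓝[>] (0 : ℝ), CFL2 s m Cs M L h (T / J h)) :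
    IsViscSubsol s m T v₀
        (upperRelaxedLimit T fun h => extScheme m h (T / J h) (ω h) v₀) ∧
      IsViscSupersol s m T v₀
        (lowerRelaxedLimit T fun h => extScheme m h (T / J h) (ω h) v₀) := by
  have hadm : ∀ᶠ h in 𝓝[>] (0 : ℝ), AdmissibleWeights (ω h) := by
    filter_upwards [hweights, self_mem_nhdsWithin] with h h1 h2
    exact ⟨hsymm h h2, hnonneg h h2, h1.summable⟩
  refine ⟨isViscSubsol_of_CFL hs hm hT hmono hbdd hadm hCs hweights hcons hJ hCFL, ?_⟩
  have hrefl := isViscSubsol_of_CFL (v₀ := fun y => -v₀ (-y)) hs hm hT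
    (fun x y hxy => neg_le_neg (hmono (neg_le_neg hxy))) (fun x => by simpa using hbdd (-x))
    hadm hCs hweights hcons hJ (hCFL.imp_right fun ⟨L, hL, hc⟩ => ⟨L, fun x y => by
      have := hL (-y) (-x)
      rwa [show -y - -x = x - y by ring, show v₀ (-y) - v₀ (-x) = -v₀ (-x) - -v₀ (-y) by ring]
        at this, hc⟩)
  convert hrefl.reflect hT hcons hadm using 1
  exact funext fun p => lowerRelaxedLimit_eq_neg (τ := fun h => T / J h) hsymm p
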